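/- Let $\Omega\subset\mathbb R^2$ be a bounded domain with smooth boundary and let $\nu$ be its unit outward normal. Let $D$ be an open set with $\overline D\subset\Omega$ and Lipschitz boundary, having finitely many connected components $D_1,\dots,D_m$ whose closures are pairwise disjoint. Let $\gamma$ be equal to a positive constant $k_j$ on each $D_j$ and to $1$ on $\Omega\setminus D$. Let $P\neq Q$ be two points of $\partial\Omega$, and set $$V(x)=-\frac1\pi\bigl(\log|P-x|-\log|Q-x|\bigr),\qquad \Psi(y)=-\frac1\pi\left(\frac{y-P}{|y-P|^2}-\frac{y-Q}{|y-Q|^2}\right)\cdot\nu(y),\quad y\in\partial\Omega\setminus\{P,Q\}.$$ Let $\mathcal E\in H^1(\Omega)$ be the weak solution of $$\nabla\cdot\gamma\nabla\mathcal E=-\nabla\cdot(\gamma-1)\nabla V\ \text{ in }\Omega,\qquad \frac{\partial\mathcal E}{\partial\nu}=-\Psi\ \text{ on }\partial\Omega,\qquad \int_{\partial\Omega}\mathcal E\,d\sigma=0,$$ that is, $\int_{\partial\Omega}\mathcal E\,d\sigma=0$ in the sense of traces and, for all $\psi\in H^1(\Omega)$, $$\int_\Omega\gamma\nabla\mathcal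 E\cdot\nabla\psi\,dx=-\int_\Omega(\gamma-1)\nabla V\cdot\nabla\psi\,dx-\int_{\partial\Omega}\Psi\,\psi\,d\sigma .$$ Put $\mathcal D=V+\mathcal E$ in $\Omega$. Then $\mathcal D$ has a locally integrable weak gradient in $\Omega$, and for every real-valued $\varphi\in H^1(\Omega)$ that is smooth (up to the boundary) in a neighbourhood of $\partial\Omega$ the function $\gamma\nabla\mathcal D\cdot\nabla\varphi$ is integrable on $\Omega$ and $$\int_\Omega\gamma\,\nabla\mathcal D\cdot\nabla\varphi\,dx=\varphi(P)-\varphi(Q).$$ In this sense $\mathcal D$ solves $\nabla\cdot\gamma\nabla\mathcal D=0$ in $\Omega$, $\partial\mathcal D/\partial\nu=\delta_P-\delta_Q$ on $\partial\Omega$. -/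

import Mathlib

open MeasureTheory Set Filter Topology
open scoped ContDiff RealInnerProductSpace

noncomputable section

namespace PointCurrent

/-- The Euclidean plane. -/
abbrev Plane : Type := EuclideanSpace ℝ (Fin 2)

/-! ### Domains, boundaries, normals -/

/-- Near `p`, and in the coordinates given by the linear isometry `L`, the set `S` is the region
strictly below the graph of `f`. -/
def IsHypographNear (S : Set Plane) (p : Plane) (L : Plane ≃ₗᵢ[ℝ] Plane) (f : ℝ → ℝ) : Prop :=
  ∃ r : ℝ, 0 < r ∧ ∀ x ∈ Metric.ball p r, (x ∈ S ↔ (L x) 1 < f ((L x) 0))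

/-- The boundary of `S` is locally a smooth graph, with `S` on one side of it. -/
def HasSmoothBoundary (S : Set Plane) : Prop :=
  ∀ p ∈ frontier S, ∃ (L : Plane ≃ₗᵢ[ℝ] Plane) (f : ℝ → ℝ),
    ContDiff ℝ ∞ f ∧ IsHypographNear S p L f

/-- The boundary of `S` is locally a Lipschitz graph, with `S` on one side of it. -/
def HasLipschitzBoundary (S : Set Plane) : Prop :=
  ∀ p ∈ frontier S, ∃ (L : Plane ≃ₗᵢ[ℝ] Plane) (f : ℝ → ℝ),
    (∃ K : NNReal, LipschitzWith K f) ∧ IsHypographNear S p L f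

/-- A bounded domain (nonempty connected open set) of the plane with smooth boundary. -/
structure IsSmoothBoundedDomain (Ω : Set Plane) : Prop where
  isOpen : IsOpen Ω
  isConnected : IsConnected Ω
  isBounded : Bornology.IsBounded Ω
  smooth : HasSmoothBoundary Ω

/-- `n` is the unit outward normal of `Ω` at the boundary point `p`: directions that make an obtuse
angle with `n` enter `Ω`, and directions that make an acute angle with `n` leave `closure Ω`. -/
def IsOutwardUnitNormal (Ω : Set Plane) (p n : Plane) : Prop :=
  ‖n‖ = 1 ∧
  (∀ v : Plane, ⟪v, n⟫ < 0 → ∀ᶠ t in 𝓝[>] (0 : ℝ), p + t • v ∈ Ω) ∧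
  (∀ v : Plane, 0 < ⟪v, n⟫ → ∀ᶠ t in 𝓝[>] (0 : ℝ), p + t • v ∉ closure Ω)

/-- The unit outward normal field `ν` on the boundary of `Ω`. -/
def outwardNormal (Ω : Set Plane) (p : Plane) : Plane :=
  Classical.epsilon (IsOutwardUnitNormal Ω p)

/-- Arc length on the boundary of `Ω`. -/
def boundaryMeasure (Ω : Set Plane) : Measure Plane :=
  (Measure.hausdorffMeasure 1).restrict (frontier Ω)

/-! ### Sobolev functions and traces -/

/-- `G` is the weak gradient of `u` on `Ω`. -/
structure HasWeakGradient (Ω : Set Plane) (u : Plane → ℝ) (G : Plane → Plane) : Prop where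
  locallyIntegrableOn : LocallyIntegrableOn u Ω
  locallyIntegrableOn_gradient : LocallyIntegrableOn G Ω
  integral_eq : ∀ ψ : Plane → ℝ, ContDiff ℝ ∞ ψ → HasCompactSupport ψ → tsupport ψ ⊆ Ω →
    ∫ x in Ω, u x • gradient ψ x = - ∫ x in Ω, ψ x • G x

/-- `u ∈ H¹(Ω)`, with weak gradient `G`. -/
structure HasH1Gradient (Ω : Set Plane) (u : Plane → ℝ) (G : Plane → Plane) : Prop where
  memLp : MemLp u 2 (volume.restrict Ω)
  memLp_gradient : MemLp G 2 (volume.restrict Ω)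
  weak : HasWeakGradient Ω u G

/-- `u ∈ H¹(Ω)`. -/
def MemH1 (Ω : Set Plane) (u : Plane → ℝ) : Prop :=
  ∃ G : Plane → Plane, HasH1Gradient Ω u G

/-- `T ∈ L²(∂Ω)` is the trace of `u ∈ H¹(Ω)`: the graph of the trace operator is the closure in
`H¹(Ω) × L²(∂Ω)` of the graph of the restriction to `∂Ω` of functions in `H¹(Ω) ∩ C(closure Ω)`. -/
def HasTrace (Ω : Set Plane) (u T : Plane → ℝ) : Prop :=
  MemLp T 2 (boundaryMeasure Ω) ∧
  ∃ (G : Plane → Plane) (w : ℕ → Plane → ℝ) (H : ℕ → Plane → Plane),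
    HasH1Gradient Ω u G ∧
    (∀ n, HasH1Gradient Ω (w n) (H n)) ∧
    (∀ n, ContinuousOn (w n) (closure Ω)) ∧
    Tendsto (fun n => eLpNorm (w n - u) 2 (volume.restrict Ω)) atTop (𝓝 0) ∧
    Tendsto (fun n => eLpNorm (H n - G) 2 (volume.restrict Ω)) atTop (𝓝 0) ∧
    Tendsto (fun n => eLpNorm (w n - T) 2 (boundaryMeasure Ω)) atTop (𝓝 0)

/-! ### Inclusions and conductivities -/

/-- `D 0, …, D (m - 1)` are the connected components of an open set whose closure lies in `Ω`, whose
boundary is Lipschitz, and whose components have pairwise disjoint closures. -/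
structure IsInclusion (Ω : Set Plane) {m : ℕ} (D : Fin m → Set Plane) : Prop where
  isOpen : ∀ j, IsOpen (D j)
  isConnected : ∀ j, IsConnected (D j)
  closure_subset : closure (⋃ j, D j) ⊆ Ω
  disjoint_closure : ∀ i j, i ≠ j → Disjoint (closure (D i)) (closure (D j))
  lipschitz : HasLipschitzBoundary (⋃ j, D j)

/-- `γ` is a positive constant on each component of the inclusion and `1` on the rest of `Ω`. -/
structure IsConductivity (Ω : Set Plane) {m : ℕ} (D : Fin m → Set Plane) (γ : Plane → ℝ) :
    Prop where
  const_on_component : ∀ j, ∃ k : ℝ, 0 < k ∧ ∀ x ∈ D j, γ x = k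
  eq_one : ∀ x ∈ Ω \ ⋃ j, D j, γ x = 1

/-! ### The singular part and the corrector -/

/-- The potential `V(P,Q;x) = -(1/π) (log |P - x| - log |Q - x|)`. -/
def V (P Q x : Plane) : ℝ :=
  -(1 / Real.pi) * (Real.log ‖P - x‖ - Real.log ‖Q - x‖)

/-- The boundary flux
`Ψ(P,Q;y) = -(1/π) ((y - P) / |y - P|² - (y - Q) / |y - Q|²) · ν(y)` on `∂Ω \ {P, Q}`. -/
def Psi (Ω : Set Plane) (P Q y : Plane) : ℝ :=
  -(1 / Real.pi) *
    ⟪(1 / ‖y - P‖ ^ 2) • (y - P) - (1 / ‖y - Q‖ ^ 2) • (y - Q), outwardNormal Ω y⟫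

/-- `e` is the `H¹(Ω)` solution of the Neumann problem
`∇·γ∇e = -∇·(γ - 1)∇V` in `Ω`, `∂e/∂ν = -Ψ` on `∂Ω`, `∫_{∂Ω} e = 0`,
in the usual weak sense, tested against all of `H¹(Ω)` (recall `γ = 1` near `∂Ω`). -/
structure IsCorrector (Ω : Set Plane) (γ : Plane → ℝ) (P Q : Plane) (e : Plane → ℝ) : Prop where
  memH1 : MemH1 Ω e
  weak_eq : ∀ (G : Plane → Plane) (φ : Plane → ℝ) (H : Plane → Plane) (T : Plane → ℝ),
    HasH1Gradient Ω e G → HasH1Gradient Ω φ H → HasTrace Ω φ T →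
    ∫ x in Ω, γ x * ⟪G x, H x⟫ =
      - (∫ x in Ω, (γ x - 1) * ⟪gradient (V P Q) x, H x⟫)
      - ∫ y, Psi Ω P Q y * T y ∂(boundaryMeasure Ω)
  mean_zero : ∃ T : Plane → ℝ, HasTrace Ω e T ∧ ∫ y, T y ∂(boundaryMeasure Ω) = 0

/-- `φ` is smooth, up to the boundary, in a neighbourhood of `∂Ω`. -/
def IsSmoothNearBoundary (Ω : Set Plane) (φ : Plane → ℝ) : Prop :=
  ∃ U : Set Plane, IsOpen U ∧ frontier Ω ⊆ U ∧ ContDiffOn ℝ ∞ φ (U ∩ closure Ω)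

end PointCurrent

end

noncomputable section

namespace PointCurrent

/-! ### Cutoff functions and gradients -/

/-! Write `K_P(x) = (x - P)/|x - P|²`, so that `∇V = -(1/π)(K_P - K_Q)` in `Ω`. Testing the
corrector equation with `φ` and adding `∫ γ ∇V·∇φ`, the terms carrying `γ` cancel and `∫ γ ∇𝒟·∇φ =
∫_Ω ∇V·∇φ - ∫_∂Ω Ψ φ`. Since `Ψ = ∇V·ν` on the boundary, everything reduces to Green's formula for a
kernel whose pole lies on the boundary (`green_pole`): `∫_Ω K_P·∇φ = ∫_∂Ω φ K_P·ν - π φ(P)`. The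
factor is `π` and not `2π` because a smooth domain occupies half of a small disc about a boundary
point.

This formula is the limit `ε → 0` of the divergence theorem for `(x - P)/(|x - P|² + ε²)`. Its
divergence has mass `2π` on the plane and concentrates at `P`; after rescaling by `ε` the domain
becomes the tangent half-plane, which by symmetry carries mass `π` (`tendsto_integral_poleDiv`). The
other two terms pass to the limit by dominated convergence. On the boundary `|(y - P)·ν(y)| ≤ C|y -
P|²`, so the flux stays bounded (`exists_abs_inner_normal_le`). Inside, `1/|x - P|` is integrable in
the plane and `∇φ` is bounded near `P` (`exists_gradient_bound`). The last point also gives the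
integrability of `γ ∇𝒟·∇φ`, although `∇V` is not square integrable.

Two foundations are built by hand. The first is the divergence theorem for a weakly differentiable
`φ` continuous up to the boundary. In a graph chart the test function is cut off at depth `δ`; as `δ
→ 0` the derivative of the cutoff turns into a boundary integral
(`IsGraphChart.tendsto_integral_slab`), identified with arc length by
`comap_hausdorffMeasure_eq_withDensity`. The second is that `φ` is its own trace (`hasTrace_self`),
so that the corrector equation applies to it: mollifying `φ` only in the interior gives `H¹`
approximations that are continuous on the closure and unchanged on the boundary. -/

theorem exists_cutoff {K W : Set Plane} (hK : IsCompact K) (hW : IsOpen W) (hKW : K ⊆ W) :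
    ∃ χ : Plane → ℝ, ContDiff ℝ ∞ χ ∧ HasCompactSupport χ ∧ tsupport χ ⊆ W ∧
      (∀ᶠ x in 𝓝ˢ K, χ x = 1) := by
  obtain ⟨K', hK', hKK', hK'W⟩ := exists_compact_between hK hW hKW
  obtain ⟨f, h1, h0, -⟩ := exists_contMDiffMap_one_nhds_of_subset_interior
    (modelWithCornersSelf ℝ Plane) (n := (⊤ : ℕ∞)) hK.isClosed hKK'
  have hs : tsupport f ⊆ K' := by
    refine closure_minimal (fun x hx => ?_) hK'.isClosed
    by_contra h
    exact hx (h0 x h)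
  exact ⟨f, f.contMDiff.contDiff, HasCompactSupport.of_support_subset_isCompact hK'
    ((subset_tsupport _).trans hs), hs.trans hK'W, h1⟩

theorem gradient_eq_toDual_symm (ψ : Plane → ℝ) :
    gradient ψ = fun x => (InnerProductSpace.toDual ℝ Plane).symm (fderiv ℝ ψ x) := rfl

theorem contDiff_gradient {ψ : Plane → ℝ} (hψ : ContDiff ℝ ∞ ψ) : ContDiff ℝ ∞ (gradient ψ) := by
  rw [gradient_eq_toDual_symm]
  exact (InnerProductSpace.toDual ℝ Plane).symm.contDiff.comp
    (hψ.fderiv_right (m := ∞) (by simp))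

theorem contDiffOn_gradient {ψ : Plane → ℝ} {W : Set Plane} (hW : IsOpen W)
    (hψ : ContDiffOn ℝ ∞ ψ W) : ContDiffOn ℝ ∞ (gradient ψ) W := by
  rw [gradient_eq_toDual_symm]
  exact (InnerProductSpace.toDual ℝ Plane).symm.contDiff.comp_contDiffOn
    (hψ.fderiv_of_isOpen hW (m := ∞) (by simp))

theorem tsupport_gradient_subset (ψ : Plane → ℝ) : tsupport (gradient ψ) ⊆ tsupport ψ := by
  refine closure_minimal (fun x hx => ?_) (isClosed_tsupport ψ)
  refine support_fderiv_subset ℝ (f := ψ) fun h => hx ?_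
  rw [gradient_eq_toDual_symm]
  simp [h]

theorem hasCompactSupport_gradient {ψ : Plane → ℝ} (h : HasCompactSupport ψ) :
    HasCompactSupport (gradient ψ) :=
  h.mono' ((subset_tsupport _).trans (tsupport_gradient_subset ψ))

theorem gradient_mul {f g : Plane → ℝ} {x : Plane} (hf : DifferentiableAt ℝ f x)
    (hg : DifferentiableAt ℝ g x) :
    gradient (fun y => f y * g y) x = f x • gradient g x + g x • gradient f x := by
  simp only [gradient_eq_toDual_symm, fderiv_fun_mul hf hg, map_add, map_smul]

theorem gradient_add {f g : Plane → ℝ} {x : Plane} (hf : DifferentiableAt ℝ f x)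
    (hg : DifferentiableAt ℝ g x) :
    gradient (fun y => f y + g y) x = gradient f x + gradient g x := by
  simp only [gradient_eq_toDual_symm, fderiv_fun_add hf hg, map_add]

/-! ### Weak gradients -/

theorem integrable_smul_of_tsupport_subset {E : Type*} [NormedAddCommGroup E] [NormedSpace ℝ E]
    {Ω : Set Plane} {u : Plane → ℝ} {v : Plane → E}
    (hu : LocallyIntegrableOn u Ω) (hv : Continuous v) (hc : HasCompactSupport v)
    (hs : tsupport v ⊆ Ω) : IntegrableOn (fun x => u x • v x) Ω := by
  have h1 : IntegrableOn (fun x => u x • v x) (tsupport v) :=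
    (hu.integrableOn_compact_subset hs hc).smul_continuousOn hv.continuousOn hc
  refine (h1.integrable_of_forall_notMem_eq_zero fun x hx => ?_).integrableOn
  simp [image_eq_zero_of_notMem_tsupport hx]

theorem integrable_smul_of_tsupport_subset' {E : Type*} [NormedAddCommGroup E] [NormedSpace ℝ E]
    {Ω : Set Plane} {u : Plane → E} {v : Plane → ℝ}
    (hu : LocallyIntegrableOn u Ω) (hv : Continuous v) (hc : HasCompactSupport v)
    (hs : tsupport v ⊆ Ω) : IntegrableOn (fun x => v x • u x) Ω := by
  have h1 : IntegrableOn (fun x => v x • u x) (tsupport v) :=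
    (hu.integrableOn_compact_subset hs hc).continuousOn_smul hv.continuousOn hc
  refine (h1.integrable_of_forall_notMem_eq_zero fun x hx => ?_).integrableOn
  simp [image_eq_zero_of_notMem_tsupport hx]

theorem setIntegral_eq_of_tsupport_subset {E F : Type*} [NormedAddCommGroup E] [NormedSpace ℝ E]
    [Zero F] {W Ω : Set Plane} (hW : W ⊆ Ω) {v : Plane → F} (hs : tsupport v ⊆ W) {g : Plane → E}
    (hg : ∀ x, v x = 0 → g x = 0) : ∫ x in Ω, g x = ∫ x in W, g x := by
  rw [setIntegral_eq_integral_of_forall_compl_eq_zero,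
    setIntegral_eq_integral_of_forall_compl_eq_zero]
  · exact fun x hx => hg x (image_eq_zero_of_notMem_tsupport fun h => hx (hs h))
  · exact fun x hx => hg x (image_eq_zero_of_notMem_tsupport fun h => hx (hW (hs h)))

theorem HasWeakGradient.mono {Ω W : Set Plane} {u : Plane → ℝ} {G : Plane → Plane}
    (h : HasWeakGradient Ω u G) (hW : W ⊆ Ω) : HasWeakGradient W u G := by
  refine ⟨h.1.mono_set hW, h.2.mono_set hW, fun ψ hψ hc hs => ?_⟩
  rw [← setIntegral_eq_of_tsupport_subset hW ((tsupport_gradient_subset ψ).trans hs)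
    (g := fun x => u x • gradient ψ x) (by intro x hx; simp [hx]),
    ← setIntegral_eq_of_tsupport_subset hW hs (g := fun x => ψ x • G x)
      (by intro x hx; simp [hx])]
  exact h.3 ψ hψ hc (hs.trans hW)

/-- The fundamental lemma of the calculus of variations. It lets any weak gradient be traded for a
convenient one, such as a classical gradient. -/
theorem HasWeakGradient.ae_eq {Ω : Set Plane} (hΩ : IsOpen Ω) {u : Plane → ℝ}
    {G G' : Plane → Plane} (h : HasWeakGradient Ω u G) (h' : HasWeakGradient Ω u G') :
    G =ᵐ[volume.restrict Ω] G' := by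
  have := hΩ.ae_eq_zero_of_integral_contDiff_smul_eq_zero (μ := volume)
    (h.locallyIntegrableOn_gradient.sub h'.locallyIntegrableOn_gradient) fun ψ hψ hc hs => by
      have h1 := h.3 ψ hψ hc hs
      rw [h'.3 ψ hψ hc hs, neg_inj] at h1
      rw [← setIntegral_eq_integral_of_forall_compl_eq_zero (s := Ω) fun x hx => by
        rw [image_eq_zero_of_notMem_tsupport fun h => hx (hs h), zero_smul]]
      simp only [Pi.sub_apply, smul_sub]
      rw [integral_sub, h1, sub_self]
      · exact integrable_smul_of_tsupport_subset' h.2 hψ.continuous hc hs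
      · exact integrable_smul_of_tsupport_subset' h'.2 hψ.continuous hc hs
  rw [Filter.EventuallyEq, ae_restrict_iff' hΩ.measurableSet]
  filter_upwards [this] with x hx hxΩ
  exact sub_eq_zero.1 (hx hxΩ)

theorem HasWeakGradient.add {Ω : Set Plane} {u v : Plane → ℝ}
    {G H : Plane → Plane} (h : HasWeakGradient Ω u G) (h' : HasWeakGradient Ω v H) :
    HasWeakGradient Ω (fun x => u x + v x) (fun x => G x + H x) := by
  refine ⟨h.1.add h'.1, h.2.add h'.2, fun ψ hψ hc hs => ?_⟩
  have hg := (contDiff_gradient hψ).continuous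
  have hgc := hasCompactSupport_gradient hc
  have hgs := (tsupport_gradient_subset ψ).trans hs
  simp only [add_smul, smul_add]
  rw [integral_add (integrable_smul_of_tsupport_subset h.1 hg hgc hgs)
      (integrable_smul_of_tsupport_subset h'.1 hg hgc hgs),
    integral_add (integrable_smul_of_tsupport_subset' h.2 hψ.continuous hc hs)
      (integrable_smul_of_tsupport_subset' h'.2 hψ.continuous hc hs), h.3 ψ hψ hc hs,
    h'.3 ψ hψ hc hs]
  abel

/-- Since `u` is smooth only in `W`, it is replaced by `χ u`, with `χ = 1` near the support of `ψ`.
This function is smooth on the whole plane and has the same values and gradients where they matter.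
-/
theorem integral_smul_gradient_eq_neg {W : Set Plane} (hW : IsOpen W) {u : Plane → ℝ}
    (hu : ContDiffOn ℝ ∞ u W) {ψ : Plane → ℝ} (hψ : ContDiff ℝ ∞ ψ) (hc : HasCompactSupport ψ)
    (hs : tsupport ψ ⊆ W) :
    ∫ x in W, u x • gradient ψ x = - ∫ x in W, ψ x • gradient u x := by
  have hg := (contDiff_gradient hψ).continuous
  have hgc := hasCompactSupport_gradient hc
  have hgs := (tsupport_gradient_subset ψ).trans hs
  obtain ⟨χ, hχ, hχc, hχs, hχ1⟩ := exists_cutoff hc hW hs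
  set w : Plane → ℝ := fun x => χ x * u x with hw
  have hwd : ContDiff ℝ ∞ w := by
    rw [contDiff_iff_contDiffAt]
    intro x
    by_cases hx : x ∈ W
    · exact hχ.contDiffAt.mul (hu.contDiffAt (hW.mem_nhds hx))
    · have : w =ᶠ[𝓝 x] fun _ => 0 := by
        have : (tsupport χ)ᶜ ∈ 𝓝 x := (isClosed_tsupport χ).isOpen_compl.mem_nhds
          fun h => hx (hχs h)
        filter_upwards [this] with y hy
        simp [hw, image_eq_zero_of_notMem_tsupport hy]
      exact contDiffAt_const.congr_of_eventuallyEq this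
  have hwu : ∀ x ∈ tsupport ψ, w =ᶠ[𝓝 x] u := by
    intro x hx
    filter_upwards [hχ1.filter_mono (nhds_le_nhdsSet hx)] with y hy
    simp [hw, hy]
  have e1 : ∀ x, u x • gradient ψ x = w x • gradient ψ x := by
    intro x
    by_cases hx : x ∈ tsupport ψ
    · rw [(hwu x hx).eq_of_nhds]
    · have : gradient ψ x = 0 :=
        image_eq_zero_of_notMem_tsupport fun h => hx (tsupport_gradient_subset ψ h)
      simp [this]
  have e2 : ∀ x, ψ x • gradient u x = ψ x • gradient w x := by
    intro x
    by_cases hx : x ∈ tsupport ψ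
    · rw [(hwu x hx).gradient_eq]
    · simp [image_eq_zero_of_notMem_tsupport hx]
  simp only [e1, e2]
  rw [setIntegral_eq_integral_of_forall_compl_eq_zero (s := W) fun x hx => by
      rw [image_eq_zero_of_notMem_tsupport (f := gradient ψ) fun h => hx (hgs h), smul_zero],
    setIntegral_eq_integral_of_forall_compl_eq_zero (s := W) fun x hx => by
      rw [image_eq_zero_of_notMem_tsupport (f := ψ) fun h => hx (hs h), zero_smul]]
  have hgw := (contDiff_gradient hwd).continuous
  have j1 : Integrable fun x => w x • gradient ψ x :=
    (hwd.continuous.smul hg).integrable_of_hasCompactSupport hgc.smul_left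
  have j2 : Integrable fun x => ψ x • gradient w x :=
    (hψ.continuous.smul hgw).integrable_of_hasCompactSupport hc.smul_right
  -- Pairing with a fixed vector reduces the claim to scalar integration by parts in the direction
  -- `v`.
  refine ext_inner_left ℝ fun v => ?_
  rw [inner_neg_right, ← integral_inner j1, ← integral_inner j2]
  have k1 : ∀ x, ⟪v, w x • gradient ψ x⟫ = w x * fderiv ℝ ψ x v := fun x => by
    rw [real_inner_smul_right, real_inner_comm, inner_gradient_left]
  have k2 : ∀ x, ⟪v, ψ x • gradient w x⟫ = fderiv ℝ w x v * ψ x := fun x => by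
    rw [real_inner_smul_right, real_inner_comm, inner_gradient_left, mul_comm]
  simp only [k1, k2]
  refine integral_mul_fderiv_eq_neg_fderiv_mul_of_integrable ?_ ?_ ?_ ?_ ?_
  · simp only [← k2]; exact j2.const_inner v
  · simp only [← k1]; exact j1.const_inner v
  · exact (hwd.continuous.mul hψ.continuous).integrable_of_hasCompactSupport hc.mul_left
  · exact fun x _ => hwd.differentiable (by simp) x
  · exact fun x _ => hψ.differentiable (by simp) x

theorem hasWeakGradient_of_contDiffOn {W : Set Plane} (hW : IsOpen W) {u : Plane → ℝ}
    (hu : ContDiffOn ℝ ∞ u W) : HasWeakGradient W u (gradient u) :=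
  ⟨hu.continuousOn.locallyIntegrableOn hW.measurableSet,
    (contDiffOn_gradient hW hu).continuousOn.locallyIntegrableOn hW.measurableSet,
    fun _ hψ hc hs => integral_smul_gradient_eq_neg hW hu hψ hc hs⟩

/-! ### Mollification in `L²` -/

theorem exists_translation_close {E : Type*} [NormedAddCommGroup E] {u : Plane → E}
    (hu : MemLp u 2 volume) {ε : ENNReal} (hε : 0 < ε) :
    ∃ δ > 0, ∀ y : Plane, ‖y‖ < δ → eLpNorm (fun x => u (x - y) - u x) 2 volume ≤ ε := by
  have : Fact ((2 : ENNReal) ≠ ⊤) := ⟨by simp⟩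
  -- Translations act continuously on `L²`; continuity at `c = 0` is the claim.
  have hc : Continuous fun c : Plane => (DomAddAct.mk (-c)) +ᵥ hu.toLp u := by fun_prop
  have h0 := hc.tendsto 0
  rw [EMetric.tendsto_nhds] at h0
  obtain ⟨δ, hδ, h⟩ := Metric.eventually_nhds_iff.1 (h0 ε hε)
  refine ⟨δ, hδ, fun y hy => ?_⟩
  have h1 := (h (y := y) (by simpa using hy)).le
  have hm : MemLp (fun x => u (-y +ᵥ x)) 2 volume :=
    hu.comp_measurePreserving (measurePreserving_vadd (-y) volume)
  have hz : (DomAddAct.mk (-(0 : Plane))) +ᵥ hu.toLp u = hu.toLp u := by simp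
  rw [hz, DomAddAct.mk_vadd_toLp, Lp.edist_toLp_toLp _ _ hm hu] at h1
  refine le_trans (le_of_eq (congrArg (fun f => eLpNorm f 2 volume) ?_)) h1
  funext x
  simp [sub_eq_neg_add]

/-- Jensen's inequality for the probability measure `ν` bounds the square of the average by the
average of the squares; Tonelli then allows the `x`-integral to be done first. -/
theorem eLpNorm_average_sub_le {E : Type*} [NormedAddCommGroup E] [NormedSpace ℝ E]
    [CompleteSpace E] {u : Plane → E}
    (hu : AEStronglyMeasurable u volume) (ν : Measure Plane) [IsProbabilityMeasure ν]
    (hi : ∀ x, Integrable (fun y => u (x - y)) ν) {ε : ENNReal}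
    (hε : ∀ᵐ y ∂ν, eLpNorm (fun x => u (x - y) - u x) 2 volume ≤ ε) :
    eLpNorm (fun x => (∫ y, u (x - y) ∂ν) - u x) 2 volume ≤ ε := by
  have hm : AEStronglyMeasurable (fun p : Plane × Plane => u (p.1 - p.2) - u p.1)
      (volume.prod ν) :=
    (hu.comp_quasiMeasurePreserving
      (quasiMeasurePreserving_sub_of_right_invariant volume ν)).sub
      (hu.comp_quasiMeasurePreserving Measure.quasiMeasurePreserving_fst)
  have hp : ∀ x, ‖(∫ y, u (x - y) ∂ν) - u x‖ₑ ^ (2 : ℝ) ≤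
      ∫⁻ y, ‖u (x - y) - u x‖ₑ ^ (2 : ℝ) ∂ν := by
    intro x
    have e1 : (∫ y, u (x - y) ∂ν) - u x = ∫ y, (u (x - y) - u x) ∂ν := by
      rw [integral_sub (hi x) (integrable_const _)]
      simp
    have h1 : ‖∫ y, (u (x - y) - u x) ∂ν‖ₑ ≤ (∫⁻ y, ‖u (x - y) - u x‖ₑ ^ (2 : ℝ) ∂ν) ^
        (1 / (2 : ℝ)) := by
      refine (enorm_integral_le_lintegral_enorm _).trans ?_
      have := eLpNorm'_le_eLpNorm'_of_exponent_le (p := 1) (q := 2) one_pos one_le_two ν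
        ((hi x).sub (integrable_const (u x))).1
      simpa [eLpNorm'] using this
    rw [e1]
    refine (ENNReal.rpow_le_rpow h1 zero_le_two).trans (le_of_eq ?_)
    rw [← ENNReal.rpow_mul]
    simp
  rw [eLpNorm_eq_lintegral_rpow_enorm_toReal (by simp) (by simp), one_div,
    ENNReal.rpow_inv_le_iff (by simp)]
  have h2 : (∫⁻ x, ∫⁻ y, ‖u (x - y) - u x‖ₑ ^ (2 : ℝ) ∂ν) ≤ ε ^ (2 : ℝ) := by
    rw [lintegral_lintegral_swap (hm.enorm.pow_const 2)]
    calc ∫⁻ y, ∫⁻ x, ‖u (x - y) - u x‖ₑ ^ (2 : ℝ) ∂volume ∂ν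
        ≤ ∫⁻ _, ε ^ (2 : ℝ) ∂ν := by
          refine lintegral_mono_ae ?_
          filter_upwards [hε] with y hy
          rw [eLpNorm_eq_lintegral_rpow_enorm_toReal (by simp) (by simp)] at hy
          refine le_trans (le_of_eq ?_) (ENNReal.rpow_le_rpow hy zero_le_two)
          rw [← ENNReal.rpow_mul]
          simp
      _ = ε ^ (2 : ℝ) := by simp
  simpa using (lintegral_mono hp).trans h2

/-- The convolution of `u` with the mollifier `ρ`. -/
def mollify {E : Type*} [NormedAddCommGroup E] [NormedSpace ℝ E] (ρ : Plane → ℝ) (u : Plane → E)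
    (x : Plane) : E :=
  ∫ y, ρ y • u (x - y)

theorem exists_mollifier {δ : ℝ} (hδ : 0 < δ) :
    ∃ ρ : Plane → ℝ, ContDiff ℝ ∞ ρ ∧ HasCompactSupport ρ ∧ (∀ y, 0 ≤ ρ y) ∧ ∫ y, ρ y = 1 ∧
      ∀ y, δ ≤ ‖y‖ → ρ y = 0 := by
  let b : ContDiffBump (0 : Plane) := ⟨δ / 2, δ, by linarith, by linarith⟩
  refine ⟨b.normed volume, b.contDiff_normed, b.hasCompactSupport_normed, b.nonneg_normed,
    b.integral_normed, fun y hy => ?_⟩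
  by_contra h
  have : y ∈ Function.support (b.normed volume) := h
  rw [b.support_normed_eq] at this
  simp only [Metric.mem_ball, dist_zero_right] at this
  exact absurd this (not_lt.2 hy)

theorem integrable_mollify {E : Type*} [NormedAddCommGroup E] [NormedSpace ℝ E] {ρ : Plane → ℝ}
    {u : Plane → E} (hρ : Continuous ρ) (hc : HasCompactSupport ρ) (hu : LocallyIntegrable u)
    (x : Plane) : Integrable fun y => ρ y • u (x - y) :=
  hc.convolutionExists_left (ContinuousLinearMap.lsmul ℝ ℝ) hρ hu x

/-- Mollification is an average of translates against the probability measure `ρ dy`, which charges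
only translations shorter than `δ`. -/
theorem eLpNorm_mollify_sub_le {E : Type*} [NormedAddCommGroup E] [NormedSpace ℝ E]
    [CompleteSpace E] {u : Plane → E} (hu : MemLp u 2 volume) {ρ : Plane → ℝ} (hρ : Continuous ρ)
    (hc : HasCompactSupport ρ) (h0 : ∀ y, 0 ≤ ρ y) (h1 : ∫ y, ρ y = 1) {δ : ℝ} {ε : ENNReal}
    (hs : ∀ y, δ ≤ ‖y‖ → ρ y = 0)
    (hε : ∀ y : Plane, ‖y‖ < δ → eLpNorm (fun x => u (x - y) - u x) 2 volume ≤ ε) :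
    eLpNorm (fun x => mollify ρ u x - u x) 2 volume ≤ ε := by
  have hρm : Measurable fun y => ENNReal.ofReal (ρ y) := hρ.measurable.ennreal_ofReal
  set ν : Measure Plane := volume.withDensity fun y => ENNReal.ofReal (ρ y) with hν
  have hνp : IsProbabilityMeasure ν := ⟨by
    rw [hν, withDensity_apply _ MeasurableSet.univ, setLIntegral_univ,
      ← ofReal_integral_eq_lintegral_ofReal (hρ.integrable_of_hasCompactSupport hc)
        (Eventually.of_forall h0), h1, ENNReal.ofReal_one]⟩
  have hl : LocallyIntegrable u := hu.locallyIntegrable (by norm_num)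
  have e : ∀ x, ∫ y, u (x - y) ∂ν = mollify ρ u x := fun x => by
    rw [hν, integral_withDensity_eq_integral_toReal_smul hρm (by simp)]
    simp only [ENNReal.toReal_ofReal (h0 _), mollify]
  simp only [← e]
  refine eLpNorm_average_sub_le hu.1 ν (fun x => ?_) ?_
  · rw [hν, integrable_withDensity_iff_integrable_smul' hρm (by simp)]
    simp only [ENNReal.toReal_ofReal (h0 _)]
    exact integrable_mollify hρ hc hl x
  · rw [hν, ae_withDensity_iff hρm]
    refine Eventually.of_forall fun y hy => hε y ?_
    by_contra h
    exact hy (by simp [hs y (not_lt.1 h)])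

theorem contDiff_mollify {u : Plane → ℝ} (hu : LocallyIntegrable u) {ρ : Plane → ℝ}
    (hρ : ContDiff ℝ ∞ ρ) (hc : HasCompactSupport ρ) : ContDiff ℝ ∞ (mollify ρ u) :=
  hc.contDiff_convolution_left (n := (⊤ : ℕ∞)) (ContinuousLinearMap.lsmul ℝ ℝ) hρ hu

theorem gradient_comp_const_sub {ρ : Plane → ℝ} (hρ : ContDiff ℝ ∞ ρ) (x t : Plane) :
    gradient (fun y => ρ (x - y)) t = - gradient ρ (x - t) := by
  have h : HasFDerivAt (fun y => ρ (x - y))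
      ((fderiv ℝ ρ (x - t)).comp (-(ContinuousLinearMap.id ℝ Plane))) t :=
    ((hρ.differentiable (by simp) (x - t)).hasFDerivAt).comp t ((hasFDerivAt_id t).const_sub x)
  simp only [gradient_eq_toDual_symm, h.fderiv, ContinuousLinearMap.comp_neg,
    ContinuousLinearMap.comp_id, map_neg]

/-- The derivative falls on `ρ`, and `y ↦ ρ (x - y)` is an admissible test function for the weak
gradient. The sign from the reflection cancels the one from integration by parts. -/
theorem gradient_mollify {u : Plane → ℝ} {g : Plane → Plane} (h : HasWeakGradient univ u g)
    {ρ : Plane → ℝ} (hρ : ContDiff ℝ ∞ ρ) (hc : HasCompactSupport ρ) :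
    gradient (mollify ρ u) = mollify ρ g := by
  have hu : LocallyIntegrable u := locallyIntegrableOn_univ.1 h.1
  funext x
  have hd := hc.hasFDerivAt_convolution_left (ContinuousLinearMap.lsmul ℝ ℝ) (μ := volume)
    (hρ.of_le (by simp)) hu x
  have hcx : HasCompactSupport fun y => ρ (x - y) := hc.comp_homeomorph (Homeomorph.subLeft x)
  have hdx : ContDiff ℝ ∞ fun y => ρ (x - y) := hρ.comp (contDiff_const.sub contDiff_id)
  have hw := h.3 (fun y => ρ (x - y)) hdx hcx (subset_univ _)
  simp only [setIntegral_univ, gradient_comp_const_sub hρ, smul_neg, integral_neg, neg_inj] at hw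
  have hm : mollify ρ g x = ∫ y, ρ (x - y) • g y := by
    rw [mollify, ← integral_sub_left_eq_self _ volume x]
    simp
  rw [hm, ← hw]
  refine ext_inner_right ℝ fun v => ?_
  rw [inner_gradient_left]
  change (fderiv ℝ (convolution ρ u (ContinuousLinearMap.lsmul ℝ ℝ) volume) x) v = _
  rw [hd.fderiv, convolution_def]
  have hgc : Continuous fun y => gradient ρ (x - y) :=
    (contDiff_gradient hρ).continuous.comp (continuous_const.sub continuous_id)
  have hgs : HasCompactSupport fun y => gradient ρ (x - y) :=
    (hasCompactSupport_gradient hc).comp_homeomorph (Homeomorph.subLeft x)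
  have i1 : Integrable fun y => u y • gradient ρ (x - y) := by
    simpa using integrable_smul_of_tsupport_subset (Ω := univ) h.1 hgc hgs (subset_univ _)
  have i2 := (hc.fderiv (𝕜 := ℝ)).convolutionExists_left
    (ContinuousLinearMap.precompL Plane (ContinuousLinearMap.lsmul ℝ ℝ)) (μ := volume)
    (hρ.continuous_fderiv (by simp)) hu x
  rw [ContinuousLinearMap.integral_apply i2, real_inner_comm, ← integral_inner i1,
    ← integral_sub_left_eq_self _ volume x]
  refine integral_congr_ae (Eventually.of_forall fun y => ?_)
  simp [real_inner_smul_right, inner_gradient_right, mul_comm]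

/-! ### Traces of functions that are continuous up to the boundary -/

theorem HasWeakGradient.neg {Ω : Set Plane} {u : Plane → ℝ} {G : Plane → Plane}
    (h : HasWeakGradient Ω u G) : HasWeakGradient Ω (fun x => - u x) (fun x => - G x) := by
  refine ⟨h.1.neg, h.2.neg, fun ψ hψ hc hs => ?_⟩
  simp only [neg_smul, smul_neg, integral_neg, h.3 ψ hψ hc hs]

/-- For an arbitrary test function `ψ` on the plane, `χ ψ` is supported in `Ω`, so the weak gradient
of `u` may be tested against it. Thus cutting off makes extension by zero harmless, and
mollification becomes available. -/
theorem HasWeakGradient.cutoff {Ω : Set Plane} {u χ : Plane → ℝ} {G : Plane → Plane}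
    (h : HasWeakGradient Ω u G) (hχ : ContDiff ℝ ∞ χ) (hc : HasCompactSupport χ)
    (hs : tsupport χ ⊆ Ω) :
    HasWeakGradient univ (fun x => χ x * u x) (fun x => χ x • G x + u x • gradient χ x) := by
  have hg := (contDiff_gradient hχ).continuous
  have hgc := hasCompactSupport_gradient hc
  have hgs := (tsupport_gradient_subset χ).trans hs
  have hext : ∀ {E : Type} [NormedAddCommGroup E] {f : Plane → E}, IntegrableOn f Ω →
      (∀ x ∉ Ω, f x = 0) → LocallyIntegrableOn f univ := fun hf h0 =>
    (hf.integrable_of_forall_notMem_eq_zero h0).locallyIntegrable.locallyIntegrableOn univ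
  have hχ0 : ∀ x ∉ Ω, χ x = 0 := fun x hx => image_eq_zero_of_notMem_tsupport fun h => hx (hs h)
  have hχ0' : ∀ x ∉ Ω, gradient χ x = 0 := fun x hx =>
    image_eq_zero_of_notMem_tsupport fun h => hx (hgs h)
  refine ⟨hext (integrable_smul_of_tsupport_subset' h.1 hχ.continuous hc hs)
      fun x hx => by simp [hχ0 x hx],
    hext ((integrable_smul_of_tsupport_subset' h.2 hχ.continuous hc hs).add
      (integrable_smul_of_tsupport_subset h.1 hg hgc hgs))
      fun x hx => by simp [hχ0 x hx, hχ0' x hx], fun ψ hψ hψc _ => ?_⟩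
  have hp : ContDiff ℝ ∞ fun x => χ x * ψ x := hχ.mul hψ
  have hpc : HasCompactSupport fun x => χ x * ψ x := hc.mul_right
  have hps : tsupport (fun x => χ x * ψ x) ⊆ Ω := (tsupport_mul_subset_left).trans hs
  have hw := h.3 _ hp hpc hps
  have e1 : ∀ x, u x • gradient (fun y => χ y * ψ y) x =
      (χ x * u x) • gradient ψ x + (ψ x * u x) • gradient χ x := fun x => by
    rw [gradient_mul (hχ.differentiable (by simp) x) (hψ.differentiable (by simp) x)]
    simp only [smul_add, smul_smul]
    congr 2 <;> ring
  have e2 : ∀ x, ψ x • (χ x • G x + u x • gradient χ x) =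
      (χ x * ψ x) • G x + (ψ x * u x) • gradient χ x := fun x => by
    simp only [smul_add, smul_smul]
    congr 2
    ring
  have i1 : IntegrableOn (fun x => (χ x * u x) • gradient ψ x) Ω := by
    have := integrable_smul_of_tsupport_subset (v := fun x => χ x • gradient ψ x) h.1
      (hχ.continuous.smul (contDiff_gradient hψ).continuous) hc.smul_right
      ((tsupport_smul_subset_left χ (gradient ψ)).trans hs)
    refine this.congr_fun_ae (Eventually.of_forall fun x => ?_)
    simp only [smul_smul, mul_comm]
  have i2 : IntegrableOn (fun x => (ψ x * u x) • gradient χ x) Ω := by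
    have := integrable_smul_of_tsupport_subset (v := fun x => ψ x • gradient χ x) h.1
      (hψ.continuous.smul hg) (HasCompactSupport.smul_left (f := ψ) hgc)
      ((tsupport_smul_subset_right ψ (gradient χ)).trans hgs)
    refine this.congr_fun_ae (Eventually.of_forall fun x => ?_)
    simp only [smul_smul, mul_comm]
  have i3 : IntegrableOn (fun x => (χ x * ψ x) • G x) Ω :=
    integrable_smul_of_tsupport_subset' h.2 hp.continuous hpc hps
  rw [setIntegral_univ, setIntegral_univ,
    ← setIntegral_eq_integral_of_forall_compl_eq_zero (s := Ω)
      (f := fun x => (χ x * u x) • gradient ψ x) (fun x hx => by simp [hχ0 x hx]),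
    ← setIntegral_eq_integral_of_forall_compl_eq_zero (s := Ω)
      (f := fun x => ψ x • (χ x • G x + u x • gradient χ x))
      (fun x hx => by simp [hχ0 x hx, hχ0' x hx])]
  simp only [e1, e2] at hw ⊢
  rw [integral_add i1 i2] at hw
  rw [integral_add i3 i2, neg_add, ← hw]
  abel

theorem memLp_of_tsupport_subset {E F : Type*} [NormedAddCommGroup E] [NormedSpace ℝ E]
    [NormedAddCommGroup F] {Ω : Set Plane}
    (hΩ : IsOpen Ω) {f : Plane → E} {g : Plane → F} {v : Plane → F}
    (hf : MemLp f 2 (volume.restrict Ω)) (hv : Continuous v) (hc : HasCompactSupport v)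
    (hs : tsupport v ⊆ Ω) (hg : AEStronglyMeasurable g (volume.restrict Ω))
    (hle : ∀ x, ‖g x‖ ≤ ‖v x‖ * ‖f x‖) :
    MemLp g 2 volume := by
  obtain ⟨C, hC⟩ := hv.bounded_above_of_compact_support hc
  have h1 : MemLp g 2 (volume.restrict Ω) := by
    refine hf.of_le_mul (c := C) hg (Eventually.of_forall fun x => (hle x).trans ?_)
    exact mul_le_mul_of_nonneg_right (hC x) (norm_nonneg _)
  have h2 := (memLp_indicator_iff_restrict hΩ.measurableSet).2 h1
  rwa [indicator_eq_self.2 fun x hx => ?_] at h2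
  by_contra h
  refine hx (norm_le_zero_iff.1 ((hle x).trans ?_))
  simp [image_eq_zero_of_notMem_tsupport fun h' => h (hs h')]

/-- Take `χ` supported in `Ω` and equal to `1` near `closure Ω \ U`, where `φ` may fail to be
continuous. Then `w = (1 - χ) φ + ρ * (χ φ)` is continuous on the closure and close to `φ` in `H¹`.
With `ρ` of small support, `w = φ` on the boundary. -/
theorem exists_continuousOn_close {Ω U : Set Plane} (hΩ : IsOpen Ω) (hb : Bornology.IsBounded Ω)
    (hU : IsOpen U) (hfU : frontier Ω ⊆ U) {φ : Plane → ℝ} {H : Plane → Plane}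
    (h : HasH1Gradient Ω φ H) (hφ : ContinuousOn φ (U ∩ closure Ω)) {ε : ENNReal} (hε : 0 < ε) (hε' : ε < ⊤) :
    ∃ (w : Plane → ℝ) (H' : Plane → Plane), HasH1Gradient Ω w H' ∧ ContinuousOn w (closure Ω) ∧
      eLpNorm (w - φ) 2 (volume.restrict Ω) ≤ ε ∧ eLpNorm (H' - H) 2 (volume.restrict Ω) ≤ ε ∧
      ∀ x ∈ frontier Ω, w x = φ x := by
  have hK : IsCompact (closure Ω \ U) := hb.isCompact_closure.diff hU
  have hKΩ : closure Ω \ U ⊆ Ω := by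
    rintro x ⟨hx, hxU⟩
    by_contra hxΩ
    exact hxU (hfU ⟨hx, by rwa [hΩ.interior_eq]⟩)
  obtain ⟨χ, hχ, hχc, hχs, hχ1⟩ := exists_cutoff hK hΩ hKΩ
  have hg := (contDiff_gradient hχ).continuous
  have hgc := hasCompactSupport_gradient hχc
  have hgs := (tsupport_gradient_subset χ).trans hχs
  set u : Plane → ℝ := fun x => χ x * φ x with hu
  set g : Plane → Plane := fun x => χ x • H x + φ x • gradient χ x with hgdef
  have hw : HasWeakGradient univ u g := h.weak.cutoff hχ hχc hχs
  have hu2 : MemLp u 2 volume :=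
    memLp_of_tsupport_subset hΩ h.memLp hχ.continuous hχc hχs
      (hχ.continuous.aestronglyMeasurable.mul h.memLp.1) fun x => by simp [hu]
  have hg2 : MemLp g 2 volume := by
    refine MemLp.add (f := fun x => χ x • H x) (g := fun x => φ x • gradient χ x) ?_ ?_
    -- The cutoff `χ` is scalar while `χ • H` is a vector, so the comparison is made for norms.
    -- Measurability of `χ • H` on the whole plane is recovered by subtracting `φ • gradient χ` from
    -- `g`.
    · have := memLp_of_tsupport_subset (g := fun x => ‖χ x • H x‖) hΩ h.memLp_gradient
        hχ.continuous hχc hχs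
        (hχ.continuous.aestronglyMeasurable.smul h.memLp_gradient.1).norm fun x => by
          simp [norm_smul]
      refine (memLp_norm_iff ?_).1 this
      exact ((locallyIntegrableOn_univ.1 hw.2).aestronglyMeasurable.sub
        ((memLp_of_tsupport_subset (g := fun x => φ x • gradient χ x) hΩ h.memLp hg hgc hgs
          (h.memLp.1.smul hg.aestronglyMeasurable) fun x => by
            simp [norm_smul, mul_comm]).1)).congr (Eventually.of_forall fun x => by
              simp [hgdef])
    · exact memLp_of_tsupport_subset hΩ h.memLp hg hgc hgs
        (h.memLp.1.smul hg.aestronglyMeasurable) fun x => by simp [norm_smul, mul_comm]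
  obtain ⟨δ₁, hδ₁, ht₁⟩ := exists_translation_close hu2 hε
  obtain ⟨δ₂, hδ₂, ht₂⟩ := exists_translation_close hg2 hε
  -- A mollifier of radius below `δ₃` keeps the support of `ρ * u` inside `Ω`, which preserves the
  -- boundary values.
  obtain ⟨δ₃, hδ₃, hth⟩ := IsCompact.exists_thickening_subset_open hχc hΩ hχs
  obtain ⟨ρ, hρ, hρc, hρ0, hρ1, hρs⟩ :=
    exists_mollifier (lt_min (lt_min hδ₁ hδ₂) hδ₃)
  have hm1 := eLpNorm_mollify_sub_le hu2 hρ.continuous hρc hρ0 hρ1 hρs fun y hy =>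
    ht₁ y (hy.trans_le ((min_le_left _ _).trans (min_le_left _ _)))
  have hm2 := eLpNorm_mollify_sub_le hg2 hρ.continuous hρc hρ0 hρ1 hρs fun y hy =>
    ht₂ y (hy.trans_le ((min_le_left _ _).trans (min_le_right _ _)))
  have hsm : ContDiff ℝ ∞ (mollify ρ u) :=
    contDiff_mollify (locallyIntegrableOn_univ.1 hw.1) hρ hρc
  have hwm : HasWeakGradient univ (mollify ρ u) (mollify ρ g) := by
    rw [← gradient_mollify hw hρ hρc]
    exact hasWeakGradient_of_contDiffOn isOpen_univ hsm.contDiffOn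
  have hm1' : MemLp (fun x => mollify ρ u x - u x) 2 volume :=
    ⟨hsm.continuous.aestronglyMeasurable.sub hu2.1, hm1.trans_lt hε'⟩
  have hm2' : MemLp (fun x => mollify ρ g x - g x) 2 volume := by
    refine ⟨AEStronglyMeasurable.sub ?_ hg2.1, hm2.trans_lt hε'⟩
    rw [← gradient_mollify hw hρ hρc]
    exact (contDiff_gradient hsm).continuous.aestronglyMeasurable
  refine ⟨fun x => φ x + (mollify ρ u x + -u x), fun x => H x + (mollify ρ g x + -g x),
    ⟨h.memLp.add ?_, h.memLp_gradient.add ?_,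
      h.weak.add ((hwm.add hw.neg).mono (subset_univ _))⟩, ?_, ?_, ?_, ?_⟩
  · simpa only [sub_eq_add_neg] using hm1'.restrict Ω
  · simpa only [sub_eq_add_neg] using hm2'.restrict Ω
  · have : (fun x => φ x + (mollify ρ u x + -u x)) =
        fun x => (1 - χ x) * φ x + mollify ρ u x := by
      funext x
      simp only [hu]
      ring
    rw [this]
    refine ContinuousOn.add (fun x hx => ?_) hsm.continuous.continuousOn
    by_cases hxU : x ∈ U
    · have h1 : ContinuousWithinAt φ (closure Ω) x :=
        (continuousWithinAt_inter' (mem_nhdsWithin_of_mem_nhds (hU.mem_nhds hxU))).1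
          (by simpa only [inter_comm] using hφ x ⟨hxU, hx⟩)
      exact (continuous_const.sub hχ.continuous).continuousWithinAt.mul h1
    · have h1 : (fun x => (1 - χ x) * φ x) =ᶠ[𝓝 x] fun _ => 0 := by
        filter_upwards [hχ1.filter_mono (nhds_le_nhdsSet (show x ∈ closure Ω \ U from ⟨hx, hxU⟩))] with y hy
        simp [hy]
      exact (continuousAt_const.congr h1.symm).continuousWithinAt
  · refine le_trans (le_of_eq ?_) ((eLpNorm_mono_measure _ (Measure.restrict_le_self (s := Ω))).trans hm1)
    congr 1
    funext x
    simp only [Pi.sub_apply]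
    ring
  · refine le_trans (le_of_eq ?_) ((eLpNorm_mono_measure _ (Measure.restrict_le_self (s := Ω))).trans hm2)
    congr 1
    funext x
    simp only [Pi.sub_apply]
    abel
  · intro x hx
    have hxΩ : x ∉ Ω := fun hx' => by
      have := hx.2
      rw [hΩ.interior_eq] at this
      exact this hx'
    have h1 : u x = 0 := by
      simp [hu, image_eq_zero_of_notMem_tsupport fun h => hxΩ (hχs h)]
    have h2 : mollify ρ u x = 0 := by
      refine integral_eq_zero_of_ae (Eventually.of_forall fun y => ?_)
      by_cases hy : ρ y = 0
      · simp [hy]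
      have hy' : ‖y‖ < δ₃ := by
        by_contra hh
        exact hy (hρs y ((min_le_right _ _).trans (not_lt.1 hh)))
      have : x - y ∉ tsupport χ := fun hxy => hxΩ (hth (Metric.mem_thickening_iff.2
        ⟨x - y, hxy, by simpa [dist_eq_norm] using hy'⟩))
      simp [hu, image_eq_zero_of_notMem_tsupport this]
    simp [h1, h2]

theorem memLp_boundaryMeasure_of_continuousOn {Ω : Set Plane} (hb : Bornology.IsBounded Ω)
    [IsFiniteMeasure (boundaryMeasure Ω)] {E : Type*} [NormedAddCommGroup E] {φ : Plane → E}
    (hφ : ContinuousOn φ (frontier Ω)) (p : ENNReal) : MemLp φ p (boundaryMeasure Ω) := by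
  have hc : IsCompact (frontier Ω) :=
    hb.isCompact_closure.of_isClosed_subset isClosed_frontier frontier_subset_closure
  obtain ⟨C, hC⟩ := hc.exists_bound_of_continuousOn hφ
  refine MemLp.of_bound (hφ.aestronglyMeasurable_of_isCompact hc hc.measurableSet) C ?_
  rw [boundaryMeasure, ae_restrict_iff' hc.measurableSet]
  exact Eventually.of_forall hC

/-- The approximations agree with `φ` on the boundary, so their restrictions converge trivially. -/
theorem hasTrace_self {Ω U : Set Plane} (hΩ : IsOpen Ω) (hb : Bornology.IsBounded Ω)
    [IsFiniteMeasure (boundaryMeasure Ω)]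
    (hU : IsOpen U) (hfU : frontier Ω ⊆ U) {φ : Plane → ℝ} {H : Plane → Plane}
    (h : HasH1Gradient Ω φ H) (hφ : ContinuousOn φ (U ∩ closure Ω)) : HasTrace Ω φ φ := by
  have hε : ∀ n : ℕ, 0 < ((n : ENNReal) + 1)⁻¹ ∧ ((n : ENNReal) + 1)⁻¹ < ⊤ := fun n =>
    ⟨ENNReal.inv_pos.2 (by simp), ENNReal.inv_lt_top.2 (by simp)⟩
  choose w H' h1 h2 h3 h4 h5 using fun n =>
    exists_continuousOn_close hΩ hb hU hfU h hφ (hε n).1 (hε n).2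
  have hlim : Tendsto (fun n : ℕ => ((n : ENNReal) + 1)⁻¹) atTop (𝓝 0) := by
    have := (tendsto_add_atTop_iff_nat 1).2 ENNReal.tendsto_inv_nat_nhds_zero
    simpa using this
  refine ⟨memLp_boundaryMeasure_of_continuousOn hb
    (hφ.mono fun x hx => ⟨hfU hx, frontier_subset_closure hx⟩) 2, H, w, H', h, h1, h2,
    tendsto_of_tendsto_of_tendsto_of_le_of_le tendsto_const_nhds hlim (fun _ => zero_le) h3,
    tendsto_of_tendsto_of_tendsto_of_le_of_le tendsto_const_nhds hlim (fun _ => zero_le) h4, ?_⟩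
  have h0 : ∀ n, eLpNorm (w n - φ) 2 (boundaryMeasure Ω) = 0 := fun n => by
    rw [eLpNorm_congr_ae (g := 0), eLpNorm_zero]
    rw [boundaryMeasure, Filter.EventuallyEq, ae_restrict_iff' isClosed_frontier.measurableSet]
    exact Eventually.of_forall fun x hx => by simp [h5 n x hx]
  simp only [h0]
  exact tendsto_const_nhds

/-! ### Length of `C¹` curves -/

section CurveLength

variable {E : Type*} [NormedAddCommGroup E] [NormedSpace ℝ E]
  [MeasurableSpace E] [BorelSpace E] {g : ℝ → E}

theorem measurableEmbedding_of_contDiff (hg : ContDiff ℝ 1 g) (hinj : Function.Injective g) :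
    MeasurableEmbedding g :=
  hg.continuous.measurableEmbedding hinj

theorem comap_hausdorffMeasure_Icc_le (hg : ContDiff ℝ 1 g) (hinj : Function.Injective g)
    {a b C : ℝ} (hC : ∀ x ∈ Icc a b, ‖deriv g x‖ ≤ C) :
    (Measure.hausdorffMeasure 1).comap g (Icc a b) ≤ ENNReal.ofReal C * ENNReal.ofReal (b - a) := by
  rw [(measurableEmbedding_of_contDiff hg hinj).comap_apply]
  have hl : LipschitzOnWith C.toNNReal g (Icc a b) := by
    refine (convex_Icc a b).lipschitzOnWith_of_nnnorm_deriv_le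
      (fun x _ => hg.differentiable (by simp) x) fun x hx => ?_
    rw [← NNReal.coe_le_coe, coe_nnnorm]
    exact (hC x hx).trans (Real.le_coe_toNNReal C)
  refine (hl.hausdorffMeasure_image_le zero_le_one).trans (le_of_eq ?_)
  rw [hausdorffMeasure_real, Real.volume_Icc, ENNReal.rpow_one]
  rfl

/-- An arc is at least as long as its chord: the distance to `g a` is a 1-Lipschitz function, so it
does not increase length, and by the intermediate value theorem it maps the arc onto an interval
containing `(0, ‖g b - g a‖]`. -/
theorem edist_le_comap_hausdorffMeasure_Ioc (hg : ContDiff ℝ 1 g) (hinj : Function.Injective g)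
    {a b : ℝ} (hab : a ≤ b) :
    ENNReal.ofReal ‖g b - g a‖ ≤ (Measure.hausdorffMeasure 1).comap g (Ioc a b) := by
  rw [(measurableEmbedding_of_contDiff hg hinj).comap_apply]
  have hl : LipschitzWith 1 fun x : E => dist x (g a) := LipschitzWith.dist_left (g a)
  have h1 := hl.hausdorffMeasure_image_le zero_le_one (g '' Ioc a b)
  simp only [ENNReal.coe_one, ENNReal.one_rpow, one_mul, hausdorffMeasure_real] at h1
  refine le_trans ?_ h1
  have h2 : Ioc 0 ‖g b - g a‖ ⊆ (fun x : E => dist x (g a)) '' (g '' Ioc a b) := by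
    intro y hy
    have hc : ContinuousOn (fun t => dist (g t) (g a)) (Icc a b) :=
      (hg.continuous.dist continuous_const).continuousOn
    have hy' : y ∈ Icc (dist (g a) (g a)) (dist (g b) (g a)) := by
      rw [dist_self, dist_eq_norm]
      exact Ioc_subset_Icc_self hy
    obtain ⟨t, ht, rfl⟩ := intermediate_value_Icc hab hc hy'
    refine ⟨g t, ⟨t, ⟨lt_of_le_of_ne ht.1 ?_, ht.2⟩, rfl⟩, rfl⟩
    rintro rfl
    simp at hy
  refine le_trans (le_of_eq ?_) (measure_mono h2)
  rw [Real.volume_Ioc, sub_zero]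

/-- The length measure of an injective `C¹` curve has the speed of the curve as density. -/
theorem comap_hausdorffMeasure_eq_withDensity (hg : ContDiff ℝ 1 g) (hinj : Function.Injective g) :
    (Measure.hausdorffMeasure 1).comap g =
      volume.withDensity fun s => ENNReal.ofReal ‖deriv g s‖ := by
  set μ : Measure ℝ := (Measure.hausdorffMeasure 1).comap g with hμ
  have hdc : Continuous (deriv g) := hg.continuous_deriv (by simp)
  have hfin : ∀ a b, μ (Icc a b) < ⊤ := fun a b => by
    obtain ⟨C, hC⟩ := isCompact_Icc.exists_bound_of_continuousOn (s := Icc a b) hdc.continuousOn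
    exact (comap_hausdorffMeasure_Icc_le hg hinj hC).trans_lt
      (ENNReal.mul_lt_top ENNReal.ofReal_lt_top ENNReal.ofReal_lt_top)
  have hfin' : ∀ a b, μ (Ioc a b) ≠ ⊤ := fun a b =>
    ((measure_mono Ioc_subset_Icc_self).trans_lt (hfin a b)).ne
  have : IsLocallyFiniteMeasure μ := ⟨fun x => ⟨Icc (x - 1) (x + 1),
    Icc_mem_nhds (by linarith) (by linarith), hfin _ _⟩⟩
  refine Measure.ext_of_Ioc _ _ fun a b hab => ?_
  -- `F` is the length of the arc from `a` to `t`. Its increments lie between the chord and the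
  -- maximal speed times the elapsed time, so its right derivative is the speed; the fundamental
  -- theorem of calculus concludes.
  set F : ℝ → ℝ := fun t => (μ (Ioc a t)).toReal with hF
  have hFsub : ∀ x y, a ≤ x → x ≤ y → F y - F x = (μ (Ioc x y)).toReal := fun x y hax hxy => by
    rw [hF, sub_eq_iff_eq_add]
    simp only
    rw [← ENNReal.toReal_add (hfin' _ _) (hfin' _ _), add_comm,
      ← measure_union (Ioc_disjoint_Ioc_of_le le_rfl) measurableSet_Ioc, Ioc_union_Ioc_eq_Ioc hax hxy]
  have hub : ∀ x y C, a ≤ x → x ≤ y → 0 ≤ C → (∀ z ∈ Icc x y, ‖deriv g z‖ ≤ C) →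
      F y - F x ≤ C * (y - x) := fun x y C hax hxy hC0 hC => by
    rw [hFsub x y hax hxy]
    have := (measure_mono Ioc_subset_Icc_self).trans (comap_hausdorffMeasure_Icc_le hg hinj hC)
    rw [← ENNReal.ofReal_mul hC0] at this
    exact ENNReal.toReal_le_of_le_ofReal (mul_nonneg hC0 (sub_nonneg.2 hxy)) this
  have hlb : ∀ x y, a ≤ x → x ≤ y → ‖g y - g x‖ ≤ F y - F x := fun x y hax hxy => by
    rw [hFsub x y hax hxy]
    exact (ENNReal.ofReal_le_iff_le_toReal (hfin' _ _)).1
      (edist_le_comap_hausdorffMeasure_Ioc hg hinj hxy)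
  have hcont : ContinuousOn F (Icc a b) := by
    obtain ⟨C, hC⟩ := isCompact_Icc.exists_bound_of_continuousOn (s := Icc a b) hdc.continuousOn
    have hC0 : 0 ≤ C := (norm_nonneg _).trans (hC a (left_mem_Icc.2 hab.le))
    have key : ∀ x ∈ Icc a b, ∀ y ∈ Icc a b, x ≤ y → dist (F x) (F y) ≤ C * dist x y := by
      intro x hx y hy hxy
      rw [dist_comm, dist_comm x y, Real.dist_eq, Real.dist_eq, abs_of_nonneg (sub_nonneg.2 hxy),
        abs_of_nonneg ((norm_nonneg _).trans (hlb x y hx.1 hxy))]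
      exact hub x y C hx.1 hxy hC0 fun z hz => hC z ⟨hx.1.trans hz.1, hz.2.trans hy.2⟩
    refine (LipschitzOnWith.of_dist_le_mul (K := ⟨C, hC0⟩) fun x hx y hy => ?_).continuousOn
    rcases le_total x y with h | h
    · exact key x hx y hy h
    · rw [dist_comm, dist_comm x y]
      exact key y hy x hx h
  have hder : ∀ x ∈ Ioo a b, HasDerivWithinAt F ‖deriv g x‖ (Ioi x) x := by
    intro x hx
    rw [hasDerivWithinAt_iff_tendsto_slope' (by simp)]
    have hgd : Tendsto (fun y => ‖slope g x y‖) (𝓝[>] x) (𝓝 ‖deriv g x‖) :=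
      ((hasDerivWithinAt_iff_tendsto_slope' (by simp)).1
        (hg.differentiable (by simp) x).hasDerivAt.hasDerivWithinAt).norm
    refine tendsto_order.2 ⟨fun c hc => ?_, fun c hc => ?_⟩
    · filter_upwards [(tendsto_order.1 hgd).1 c hc, self_mem_nhdsWithin] with y hy hxy
      refine hy.trans_le ?_
      have hpos : 0 < y - x := sub_pos.2 hxy
      rw [slope_def_module, slope_def_field, norm_smul, norm_inv, Real.norm_of_nonneg hpos.le,
        inv_mul_eq_div]
      exact div_le_div_of_nonneg_right (hlb x y hx.1.le (le_of_lt hxy)) hpos.le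
    · obtain ⟨d, hd1, hd2⟩ := exists_between hc
      have hev : ∀ᶠ z in 𝓝 x, ‖deriv g z‖ < d :=
        hdc.norm.continuousAt.eventually (gt_mem_nhds hd1)
      obtain ⟨r, hr, hball⟩ := Metric.eventually_nhds_iff.1 hev
      filter_upwards [Ioo_mem_nhdsGT (show x < x + r by linarith)] with y hy
      have hpos : 0 < y - x := sub_pos.2 hy.1
      refine lt_of_le_of_lt ?_ hd2
      rw [slope_def_field, div_le_iff₀ hpos]
      refine hub x y d hx.1.le hy.1.le ((norm_nonneg _).trans hd1.le) fun z hz => (hball ?_).le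
      rw [Real.dist_eq, abs_of_nonneg (sub_nonneg.2 hz.1)]
      linarith [hz.2, hy.2]
  have hFTC := intervalIntegral.integral_eq_sub_of_hasDeriv_right
    (by rwa [uIcc_of_le hab.le]) (by rwa [min_eq_left hab.le, max_eq_right hab.le])
    (hdc.norm.intervalIntegrable a b)
  have hFa : F a = 0 := by simp [hF]
  rw [hFa, sub_zero, intervalIntegral.integral_of_le hab.le] at hFTC
  rw [withDensity_apply _ measurableSet_Ioc, ← ofReal_integral_eq_lintegral_ofReal
    (hdc.norm.integrableOn_Ioc) (Eventually.of_forall fun _ => norm_nonneg _), hFTC, hF,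
    ENNReal.ofReal_toReal (hfin' _ _)]

theorem setIntegral_hausdorffMeasure_range (hg : ContDiff ℝ 1 g) (hinj : Function.Injective g)
    {F : Type*} [NormedAddCommGroup F] [NormedSpace ℝ F] (h : E → F) :
    ∫ y in range g, h y ∂(Measure.hausdorffMeasure 1) = ∫ s, ‖deriv g s‖ • h (g s) := by
  have hm := measurableEmbedding_of_contDiff hg hinj
  rw [← hm.map_comap, hm.integral_map, comap_hausdorffMeasure_eq_withDensity hg hinj,
    integral_withDensity_eq_integral_toReal_smul
      (hg.continuous_deriv (by simp)).norm.measurable.ennreal_ofReal (by simp)]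
  simp only [ENNReal.toReal_ofReal (norm_nonneg _)]

end CurveLength

/-! ### Graph coordinates near a boundary point -/

/-- The point of the graph of `f` above `s`, in the coordinates given by `L`. -/
def graphPt (L : Plane ≃ₗᵢ[ℝ] Plane) (f : ℝ → ℝ) (s : ℝ) : Plane := L.symm !₂[s, f s]

/-- The upward normal, with vertical component `1`, to the graph of `f`, in the coordinates given by `L`. -/
def graphNormal (L : Plane ≃ₗᵢ[ℝ] Plane) (f : ℝ → ℝ) (s : ℝ) : Plane := L.symm !₂[-deriv f s, 1]

/-- The vertical depth of a point below the graph of `f`, in the coordinates given by `L`. -/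
def depth (L : Plane ≃ₗᵢ[ℝ] Plane) (f : ℝ → ℝ) (x : Plane) : ℝ := f ((L x) 0) - (L x) 1

/-- In the ball of radius `r` about `p`, the set `Ω` is the hypograph of the smooth function `f`. -/
structure IsGraphChart (Ω : Set Plane) (p : Plane) (L : Plane ≃ₗᵢ[ℝ] Plane) (f : ℝ → ℝ)
    (r : ℝ) : Prop where
  contDiff : ContDiff ℝ ∞ f
  pos : 0 < r
  mem_iff : ∀ x ∈ Metric.ball p r, x ∈ Ω ↔ 0 < depth L f x

theorem HasSmoothBoundary.exists_isGraphChart {Ω : Set Plane} (h : HasSmoothBoundary Ω) {p : Plane}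
    (hp : p ∈ frontier Ω) : ∃ L f r, IsGraphChart Ω p L f r := by
  obtain ⟨L, f, hf, r, hr, hm⟩ := h p hp
  exact ⟨L, f, r, hf, hr, fun x hx => by rw [hm x hx, depth, sub_pos]⟩

section Graph

variable {L : Plane ≃ₗᵢ[ℝ] Plane} {f : ℝ → ℝ}

theorem inner_symm_toLp (x : Plane) (a b : ℝ) :
    ⟪x, L.symm !₂[a, b]⟫ = a * (L x) 0 + b * (L x) 1 := by
  have : ⟪x, L.symm !₂[a, b]⟫ = ⟪L x, !₂[a, b]⟫ := by
    rw [← L.inner_map_map, L.apply_symm_apply]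
  rw [this]
  simp [PiLp.inner_apply, Fin.sum_univ_two]

theorem norm_graphNormal_sq (s : ℝ) : ‖graphNormal L f s‖ ^ 2 = deriv f s ^ 2 + 1 := by
  rw [graphNormal, LinearIsometryEquiv.norm_map, EuclideanSpace.norm_sq_eq]
  simp [Fin.sum_univ_two]

theorem graphNormal_ne_zero (s : ℝ) : graphNormal L f s ≠ 0 := fun h => by
  have := norm_graphNormal_sq (L := L) (f := f) s
  rw [h, norm_zero] at this
  nlinarith [sq_nonneg (deriv f s)]

theorem norm_graphNormal_pos (s : ℝ) : 0 < ‖graphNormal L f s‖ :=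
  norm_pos_iff.2 (graphNormal_ne_zero s)

@[simp]
theorem apply_graphPt_zero (s : ℝ) : (L (graphPt L f s)) 0 = s := by simp [graphPt]

@[simp]
theorem apply_graphPt_one (s : ℝ) : (L (graphPt L f s)) 1 = f s := by simp [graphPt]

@[simp]
theorem depth_graphPt (s : ℝ) : depth L f (graphPt L f s) = 0 := by simp [depth]

theorem graphPt_of_depth_eq_zero {x : Plane} (h : depth L f x = 0) :
    graphPt L f ((L x) 0) = x := by
  rw [graphPt, LinearIsometryEquiv.symm_apply_eq]
  ext i
  fin_cases i
  · simp
  · simpa [depth, sub_eq_zero] using h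

theorem injective_graphPt : Function.Injective (graphPt L f) := fun s t h => by
  rw [← apply_graphPt_zero (L := L) (f := f) s, h, apply_graphPt_zero]

theorem mem_range_graphPt_iff {x : Plane} : x ∈ range (graphPt L f) ↔ depth L f x = 0 :=
  ⟨by rintro ⟨s, rfl⟩; simp, fun h => ⟨_, graphPt_of_depth_eq_zero h⟩⟩

theorem hasDerivAt_toLp_pair {a b : ℝ → ℝ} {a' b' s : ℝ} (ha : HasDerivAt a a' s)
    (hb : HasDerivAt b b' s) : HasDerivAt (fun t => (!₂[a t, b t] : Plane)) !₂[a', b'] s := by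
  have h : HasDerivAt (fun t => ![a t, b t]) ![a', b'] s := by
    rw [hasDerivAt_pi]
    intro i
    fin_cases i
    · simpa using ha
    · simpa using hb
  exact ((PiLp.continuousLinearEquiv 2 ℝ fun _ : Fin 2 => ℝ).symm.toContinuousLinearMap
    |>.hasFDerivAt).comp_hasDerivAt s h

theorem hasDerivAt_graphPt (hf : ContDiff ℝ ∞ f) (s : ℝ) :
    HasDerivAt (graphPt L f) (L.symm !₂[1, deriv f s]) s :=
  (L.symm.toContinuousLinearEquiv.toContinuousLinearMap.hasFDerivAt).comp_hasDerivAt s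
    (hasDerivAt_toLp_pair (hasDerivAt_id s) (hf.differentiable (by simp) s).hasDerivAt)

theorem norm_deriv_graphPt (hf : ContDiff ℝ ∞ f) (s : ℝ) :
    ‖deriv (graphPt L f) s‖ = ‖graphNormal L f s‖ := by
  rw [(hasDerivAt_graphPt hf s).deriv, graphNormal, LinearIsometryEquiv.norm_map,
    LinearIsometryEquiv.norm_map, EuclideanSpace.norm_eq, EuclideanSpace.norm_eq]
  simp [Fin.sum_univ_two, add_comm]

theorem contDiff_toLp_pair {a b : ℝ → ℝ} {n : WithTop ℕ∞} (ha : ContDiff ℝ n a)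
    (hb : ContDiff ℝ n b) : ContDiff ℝ n fun t => (!₂[a t, b t] : Plane) := by
  rw [contDiff_euclidean]
  intro i
  fin_cases i
  · simpa using ha
  · simpa using hb

theorem contDiff_graphPt (hf : ContDiff ℝ ∞ f) : ContDiff ℝ 1 (graphPt L f) :=
  L.symm.contDiff.comp (contDiff_toLp_pair contDiff_id (hf.of_le (by simp)))

theorem continuous_graphNormal (hf : ContDiff ℝ ∞ f) : Continuous (graphNormal L f) :=
  L.symm.continuous.comp (contDiff_toLp_pair (n := 0)
    (contDiff_zero.2 (hf.continuous_deriv (by simp)).neg) contDiff_const).continuous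

theorem contDiff_coord (i : Fin 2) {n : WithTop ℕ∞} : ContDiff ℝ n fun x : Plane => (L x) i :=
  (contDiff_euclidean.1 L.contDiff) i

theorem contDiff_depth (hf : ContDiff ℝ ∞ f) : ContDiff ℝ ∞ (depth L f) :=
  (hf.comp (contDiff_coord 0)).sub (contDiff_coord 1)

theorem hasGradientAt_coord (i : Fin 2) (x : Plane) :
    HasGradientAt (fun x : Plane => (L x) i) (L.symm (EuclideanSpace.single i 1)) x := by
  rw [hasGradientAt_iff_hasFDerivAt]
  have h : HasFDerivAt (fun x : Plane => (L x) i) ((EuclideanSpace.proj (𝕜 := ℝ) i).comp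
      L.toContinuousLinearEquiv.toContinuousLinearMap) x :=
    ((EuclideanSpace.proj (𝕜 := ℝ) i).comp
      L.toContinuousLinearEquiv.toContinuousLinearMap).hasFDerivAt
  refine h.congr_fderiv (ContinuousLinearMap.ext fun v => ?_)
  rw [InnerProductSpace.toDual_apply_apply, ← L.inner_map_map, L.apply_symm_apply]
  simp [EuclideanSpace.inner_single_left]

theorem gradient_depth (hf : ContDiff ℝ ∞ f) (x : Plane) :
    gradient (depth L f) x = - graphNormal L f ((L x) 0) := by
  have h0 := (hasGradientAt_iff_hasFDerivAt.1 (hasGradientAt_coord (L := L) 0 x))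
  have h1 := (hasGradientAt_iff_hasFDerivAt.1 (hasGradientAt_coord (L := L) 1 x))
  have h2 := ((hf.differentiable (by simp) ((L x) 0)).hasDerivAt.comp_hasFDerivAt x h0).sub h1
  have h3 : HasGradientAt (depth L f) (deriv f ((L x) 0) • L.symm (EuclideanSpace.single 0 1) -
      L.symm (EuclideanSpace.single 1 1)) x := by
    rw [hasGradientAt_iff_hasFDerivAt, map_sub, map_smul]
    exact h2
  rw [h3.gradient, graphNormal, ← map_smul, ← map_sub, ← map_neg]
  congr 1
  ext i
  fin_cases i <;> simp

theorem hasDerivAt_depth_ray (hf : ContDiff ℝ ∞ f) (x v : Plane) :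
    HasDerivAt (fun t : ℝ => depth L f (x + t • v)) (-⟪v, graphNormal L f ((L x) 0)⟫) 0 := by
  have h1 : HasFDerivAt (depth L f) (fderiv ℝ (depth L f) x) (x + (0 : ℝ) • v) := by
    simpa using ((contDiff_depth hf).differentiable (by simp) x).hasFDerivAt
  have h2 : HasDerivAt (fun t : ℝ => x + t • v) v 0 := by
    simpa using ((hasDerivAt_id (0 : ℝ)).smul_const v).const_add x
  have h3 := h1.comp_hasDerivAt (0 : ℝ) h2
  rwa [← inner_gradient_left, gradient_depth hf, inner_neg_left, real_inner_comm] at h3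

end Graph

/-! ### Outward normal and boundary measure in a graph chart -/

theorem eventually_pos_of_hasDerivAt {h : ℝ → ℝ} {h' : ℝ} (hd : HasDerivAt h h' 0) (h0 : h 0 = 0)
    (hpos : 0 < h') : ∀ᶠ t in 𝓝[>] (0 : ℝ), 0 < h t := by
  have hs : Tendsto (slope h 0) (𝓝[>] 0) (𝓝 h') :=
    (hasDerivWithinAt_iff_tendsto_slope' (by simp)).1 hd.hasDerivWithinAt
  filter_upwards [(tendsto_order.1 hs).1 0 hpos, self_mem_nhdsWithin] with t ht ht0
  rw [slope_def_field, h0, sub_zero, sub_zero] at ht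
  exact (div_pos_iff_of_pos_right ht0).1 ht

/-- If `n ≠ n'`, the direction `n' - n` is obtuse to `n` and acute to `n'`, so its ray would both
enter `Ω` and leave the closure. Uniqueness is what makes `outwardNormal`, a choice by
`Classical.epsilon`, computable in charts. -/
theorem IsOutwardUnitNormal.unique {Ω : Set Plane} {p n n' : Plane}
    (h : IsOutwardUnitNormal Ω p n) (h' : IsOutwardUnitNormal Ω p n') : n = n' := by
  by_contra hne
  have h1 : ⟪n, n'⟫ < 1 := (inner_lt_one_iff_real_of_norm_eq_one h.1 h'.1).2 hne
  have a : ⟪n' - n, n⟫ < 0 := by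
    rw [inner_sub_left, real_inner_self_eq_norm_sq, h.1, real_inner_comm]
    linarith
  have b : 0 < ⟪n' - n, n'⟫ := by
    rw [inner_sub_left, real_inner_self_eq_norm_sq, h'.1]
    linarith
  obtain ⟨t, ht1, ht2⟩ := ((h.2.1 _ a).and (h'.2.2 _ b)).exists
  exact ht2 (subset_closure ht1)

namespace IsGraphChart

variable {Ω : Set Plane} {p : Plane} {L : Plane ≃ₗᵢ[ℝ] Plane} {f : ℝ → ℝ} {r : ℝ}

theorem notMem_closure (h : IsGraphChart Ω p L f r) {x : Plane} (hx : x ∈ Metric.ball p r)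
    (hd : depth L f x < 0) : x ∉ closure Ω := by
  rw [mem_closure_iff_nhds]
  push Not
  refine ⟨Metric.ball p r ∩ {y | depth L f y < 0}, ?_, ?_⟩
  · exact inter_mem (Metric.isOpen_ball.mem_nhds hx)
      ((contDiff_depth h.contDiff).continuous.continuousAt.eventually (gt_mem_nhds hd))
  · rw [eq_empty_iff_forall_notMem]
    rintro y ⟨⟨hy, hy'⟩, hyΩ⟩
    exact absurd ((h.mem_iff y hy).1 hyΩ) (not_lt.2 (le_of_lt hy'))

theorem eventually_mem_ball {x v : Plane} (hx : x ∈ Metric.ball p r) :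
    ∀ᶠ t in 𝓝[>] (0 : ℝ), x + t • v ∈ Metric.ball p r := by
  have hc : Continuous fun t : ℝ => x + t • v := by fun_prop
  exact (hc.continuousAt.eventually (Metric.isOpen_ball.mem_nhds (by simpa using hx))).filter_mono
    nhdsWithin_le_nhds

/-- The derivative of the depth along `v` is minus the inner product of `v` with the graph normal,
so its sign tells on which side of the graph the ray starts. -/
theorem isOutwardUnitNormal (h : IsGraphChart Ω p L f r) {x : Plane} (hx : x ∈ Metric.ball p r)
    (hd : depth L f x = 0) : IsOutwardUnitNormal Ω x
      (‖graphNormal L f ((L x) 0)‖⁻¹ • graphNormal L f ((L x) 0)) := by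
  have hN := norm_graphNormal_pos (L := L) (f := f) ((L x) 0)
  refine ⟨by rw [norm_smul, norm_inv, norm_norm, inv_mul_cancel₀ hN.ne'], fun v hv => ?_,
    fun v hv => ?_⟩
  · rw [real_inner_smul_right] at hv
    have hv' : 0 < -⟪v, graphNormal L f ((L x) 0)⟫ := by
      have := (mul_neg_iff.1 hv).resolve_right fun h' => absurd h'.1 (not_lt.2 (by positivity))
      linarith [this.2]
    filter_upwards [eventually_pos_of_hasDerivAt (hasDerivAt_depth_ray h.contDiff x v)
      (by simpa using hd) hv', eventually_mem_ball (v := v) hx] with t ht ht'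
    exact (h.mem_iff _ ht').2 ht
  · rw [real_inner_smul_right] at hv
    have hv' : 0 < - -⟪v, graphNormal L f ((L x) 0)⟫ := by
      rw [neg_neg]
      exact (pos_iff_pos_of_mul_pos hv).1 (by positivity)
    filter_upwards [eventually_pos_of_hasDerivAt (hasDerivAt_depth_ray h.contDiff x v).neg
      (by simpa using hd) hv', eventually_mem_ball (v := v) hx] with t ht ht'
    exact h.notMem_closure ht' (by simpa using ht)

theorem outwardNormal_eq (h : IsGraphChart Ω p L f r) {x : Plane} (hx : x ∈ Metric.ball p r)
    (hd : depth L f x = 0) : outwardNormal Ω x =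
      ‖graphNormal L f ((L x) 0)‖⁻¹ • graphNormal L f ((L x) 0) :=
  (Classical.epsilon_spec ⟨_, h.isOutwardUnitNormal hx hd⟩).unique (h.isOutwardUnitNormal hx hd)

theorem mem_frontier_iff (h : IsGraphChart Ω p L f r) (hΩ : IsOpen Ω) {x : Plane}
    (hx : x ∈ Metric.ball p r) : x ∈ frontier Ω ↔ depth L f x = 0 := by
  rw [frontier, hΩ.interior_eq]
  constructor
  · rintro ⟨h1, h2⟩
    rw [h.mem_iff x hx, not_lt] at h2
    by_contra hne
    exact h.notMem_closure hx (lt_of_le_of_ne h2 hne) h1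
  · intro hd
    refine ⟨?_, fun hxΩ => absurd ((h.mem_iff x hx).1 hxΩ) hd.not_gt⟩
    have hn := h.isOutwardUnitNormal hx hd
    set n := ‖graphNormal L f ((L x) 0)‖⁻¹ • graphNormal L f ((L x) 0)
    -- Points slightly inward along the normal belong to `Ω` and tend to `x`.
    have h1 := hn.2.1 (-n) (by rw [inner_neg_left, real_inner_self_eq_norm_sq, hn.1]; norm_num)
    have hc : Tendsto (fun t : ℝ => x + t • (-n)) (𝓝[>] 0) (𝓝 x) := by
      have : Continuous fun t : ℝ => x + t • (-n) := by fun_prop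
      simpa using (this.tendsto 0).mono_left nhdsWithin_le_nhds
    exact mem_closure_of_tendsto hc h1

theorem setIntegral_boundaryMeasure (h : IsGraphChart Ω p L f r) (hΩ : IsOpen Ω) {F : Type*}
    [NormedAddCommGroup F] [NormedSpace ℝ F] {k : Plane → F}
    (hk : ∀ x ∉ Metric.ball p r, k x = 0) :
    ∫ y, k y ∂(boundaryMeasure Ω) = ∫ s, ‖graphNormal L f s‖ • k (graphPt L f s) := by
  have hinj := injective_graphPt (L := L) (f := f)
  have hc := contDiff_graphPt (L := L) h.contDiff
  have e : (frontier Ω).indicator k = (range (graphPt L f)).indicator k := by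
    funext x
    by_cases hx : x ∈ Metric.ball p r
    · simp only [indicator, h.mem_frontier_iff hΩ hx, mem_range_graphPt_iff]
    · simp only [indicator, hk x hx, ite_self]
  have hm : MeasurableSet (range (graphPt L f)) :=
    (measurableEmbedding_of_contDiff hc hinj).measurableSet_range
  rw [boundaryMeasure, ← integral_indicator isClosed_frontier.measurableSet, e,
    integral_indicator hm, setIntegral_hausdorffMeasure_range hc hinj]
  simp only [norm_deriv_graphPt h.contDiff]

theorem exists_hausdorffMeasure_lt_top (h : IsGraphChart Ω p L f r) (hΩ : IsOpen Ω) :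
    Measure.hausdorffMeasure 1 (frontier Ω ∩ Metric.ball p r) < ⊤ := by
  have hinj := injective_graphPt (L := L) (f := f)
  have hc := contDiff_graphPt (L := L) h.contDiff
  have hs : frontier Ω ∩ Metric.ball p r ⊆ graphPt L f '' Icc ((L p) 0 - r) ((L p) 0 + r) := by
    rintro x ⟨hx, hxb⟩
    refine ⟨(L x) 0, ?_, graphPt_of_depth_eq_zero ((h.mem_frontier_iff hΩ hxb).1 hx)⟩
    have h1 : |(L x) 0 - (L p) 0| ≤ ‖L x - L p‖ := by
      simpa using PiLp.norm_apply_le (L x - L p) 0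
    rw [← map_sub, L.norm_map, ← dist_eq_norm] at h1
    have h2 := abs_le.1 (h1.trans (Metric.mem_ball.1 hxb).le)
    exact ⟨by linarith [h2.1], by linarith [h2.2]⟩
  refine (measure_mono hs).trans_lt ?_
  rw [← (measurableEmbedding_of_contDiff hc hinj).comap_apply]
  obtain ⟨C, hC⟩ := isCompact_Icc.exists_bound_of_continuousOn
    (s := Icc ((L p) 0 - r) ((L p) 0 + r)) (hc.continuous_deriv (by simp)).continuousOn
  exact (comap_hausdorffMeasure_Icc_le hc hinj hC).trans_lt
    (ENNReal.mul_lt_top ENNReal.ofReal_lt_top ENNReal.ofReal_lt_top)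

/-- Up to normalisation the inner product is the first-order Taylor remainder of `f` about the
coordinate of `y`, which is quadratic because `f'` is Lipschitz near the coordinate of `p`. This
cancels the singularity of the boundary flux at the pole. -/
theorem abs_inner_normal_le (h : IsGraphChart Ω p L f r) (hΩ : IsOpen Ω) (hp : p ∈ frontier Ω) :
    ∃ C δ : ℝ, 0 < δ ∧ ∀ y ∈ frontier Ω, y ∈ Metric.ball p δ →
      |⟪y - p, outwardNormal Ω y⟫| ≤ C * ‖y - p‖ ^ 2 := by
  have hf' : ContDiff ℝ 1 (deriv f) := by
    refine ContDiff.deriv' ?_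
    rw [one_add_one_eq_two]
    exact contDiff_infty.1 h.contDiff 2
  obtain ⟨K, t, ht, hK⟩ := (hf'.contDiffAt (x := (L p) 0)).exists_lipschitzOnWith
  obtain ⟨η, hη, hηt⟩ := Metric.mem_nhds_iff.1 ht
  have hpd : depth L f p = 0 := (h.mem_frontier_iff hΩ (Metric.mem_ball_self h.pos)).1 hp
  refine ⟨K, min r η, lt_min h.pos hη, fun y hy hyb => ?_⟩
  have hyr : y ∈ Metric.ball p r := Metric.ball_subset_ball (min_le_left _ _) hyb
  have hyd : depth L f y = 0 := (h.mem_frontier_iff hΩ hyr).1 hy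
  set a := (L p) 0
  set b := (L y) 0
  have hab : |b - a| ≤ ‖y - p‖ := by
    have : |(L (y - p)) 0| ≤ ‖L (y - p)‖ := by
      simpa using PiLp.norm_apply_le (L (y - p)) 0
    rwa [L.norm_map, map_sub] at this
  have hbη : |b - a| < η :=
    hab.trans_lt (by simpa [dist_eq_norm] using (Metric.mem_ball.1 hyb).trans_le (min_le_right _ _))
  have hin : ⟪y - p, graphNormal L f b⟫ = f b - f a - deriv f b * (b - a) := by
    rw [graphNormal, inner_symm_toLp, map_sub]
    simp only [depth, sub_eq_zero] at hpd hyd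
    simp only [PiLp.sub_apply, ← hpd, ← hyd]
    ring
  have hmv : |f b - f a - deriv f b * (b - a)| ≤ K * |b - a| * |b - a| := by
    have hseg : ∀ z ∈ uIcc a b, |z - b| ≤ |b - a| ∧ z ∈ t := fun z hz => by
      have h1 : |z - b| ≤ |b - a| := by
        rw [abs_sub_comm]
        exact abs_sub_right_of_mem_uIcc hz
      have h2 : |z - a| ≤ |b - a| := abs_sub_left_of_mem_uIcc hz
      exact ⟨h1, hηt (by rw [Metric.mem_ball, Real.dist_eq]; exact h2.trans_lt hbη)⟩
    -- Mean value inequality for `f z - f'(b) z`, whose derivative is at most `K |b - a|` between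
    -- `a` and `b`.
    have := (convex_uIcc a b).norm_image_sub_le_of_norm_hasDerivWithin_le
      (f := fun z => f z - deriv f b * z) (f' := fun z => deriv f z - deriv f b)
      (C := K * |b - a|) (fun z hz => (((h.contDiff.differentiable (by simp) z).hasDerivAt).sub
        (by simpa using (hasDerivAt_id z).const_mul (deriv f b))).hasDerivWithinAt)
      (fun z hz => by
        have h1 := hK.dist_le_mul z (hseg z hz).2 b (hseg b right_mem_uIcc).2
        rw [Real.dist_eq, Real.dist_eq] at h1
        exact h1.trans (mul_le_mul_of_nonneg_left (hseg z hz).1 K.2))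
      left_mem_uIcc right_mem_uIcc
    simp only [Real.norm_eq_abs] at this
    convert this using 2
    ring
  have hN1 : 1 ≤ ‖graphNormal L f b‖ := by
    have := norm_graphNormal_sq (L := L) (f := f) b
    nlinarith [sq_nonneg (deriv f b), norm_nonneg (graphNormal L f b)]
  rw [h.outwardNormal_eq hyr hyd, real_inner_smul_right, abs_mul, abs_inv, abs_norm, hin]
  calc ‖graphNormal L f b‖⁻¹ * |f b - f a - deriv f b * (b - a)|
      ≤ 1 * |f b - f a - deriv f b * (b - a)| :=
        mul_le_mul_of_nonneg_right (inv_le_one_of_one_le₀ hN1) (abs_nonneg _)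
    _ ≤ K * |b - a| * |b - a| := by rw [one_mul]; exact hmv
    _ ≤ K * ‖y - p‖ ^ 2 := by
        rw [mul_assoc, pow_two]
        exact mul_le_mul_of_nonneg_left (mul_le_mul hab hab (abs_nonneg _) (norm_nonneg _)) K.2

end IsGraphChart

/-! ### The boundary of a smooth bounded domain -/

namespace IsSmoothBoundedDomain

variable {Ω : Set Plane}

theorem isCompact_frontier (hΩ : IsSmoothBoundedDomain Ω) : IsCompact (frontier Ω) :=
  hΩ.isBounded.isCompact_closure.of_isClosed_subset isClosed_frontier frontier_subset_closure

theorem isFiniteMeasure_boundaryMeasure (hΩ : IsSmoothBoundedDomain Ω) :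
    IsFiniteMeasure (boundaryMeasure Ω) := by
  refine ⟨?_⟩
  rw [boundaryMeasure, Measure.restrict_apply_univ]
  refine hΩ.isCompact_frontier.measure_lt_top_of_nhdsWithin fun p hp => ?_
  obtain ⟨L, f, r, h⟩ := hΩ.smooth.exists_isGraphChart hp
  exact ⟨_, inter_mem_nhdsWithin _ (Metric.ball_mem_nhds p h.pos),
    h.exists_hausdorffMeasure_lt_top hΩ.isOpen⟩

theorem isOutwardUnitNormal (hΩ : IsSmoothBoundedDomain Ω) {p : Plane} (hp : p ∈ frontier Ω) :
    IsOutwardUnitNormal Ω p (outwardNormal Ω p) := by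
  obtain ⟨L, f, r, h⟩ := hΩ.smooth.exists_isGraphChart hp
  have hb := Metric.mem_ball_self (x := p) h.pos
  exact Classical.epsilon_spec
    ⟨_, h.isOutwardUnitNormal hb ((h.mem_frontier_iff hΩ.isOpen hb).1 hp)⟩

theorem continuousOn_outwardNormal (hΩ : IsSmoothBoundedDomain Ω) :
    ContinuousOn (outwardNormal Ω) (frontier Ω) := by
  intro p hp
  obtain ⟨L, f, r, h⟩ := hΩ.smooth.exists_isGraphChart hp
  have hb := Metric.ball_mem_nhds p h.pos
  have hc : Continuous fun x : Plane =>
      ‖graphNormal L f ((L x) 0)‖⁻¹ • graphNormal L f ((L x) 0) := by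
    have : Continuous fun x : Plane => graphNormal L f ((L x) 0) :=
      (continuous_graphNormal h.contDiff).comp (contDiff_coord (n := 0) 0).continuous
    exact (this.norm.inv₀ fun x => (norm_graphNormal_pos _).ne').smul this
  refine hc.continuousWithinAt.congr_of_eventuallyEq ?_ ?_
  · filter_upwards [mem_nhdsWithin_of_mem_nhds hb, self_mem_nhdsWithin] with x hx hx'
    exact h.outwardNormal_eq hx ((h.mem_frontier_iff hΩ.isOpen hx).1 hx')
  · have hb := Metric.mem_ball_self (x := p) h.pos
    exact h.outwardNormal_eq hb ((h.mem_frontier_iff hΩ.isOpen hb).1 hp)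

theorem exists_abs_inner_normal_le (hΩ : IsSmoothBoundedDomain Ω) {p : Plane}
    (hp : p ∈ frontier Ω) :
    ∃ C : ℝ, ∀ y ∈ frontier Ω, |⟪y - p, outwardNormal Ω y⟫| ≤ C * ‖y - p‖ ^ 2 := by
  obtain ⟨L, f, r, h⟩ := hΩ.smooth.exists_isGraphChart hp
  obtain ⟨C, δ, hδ, hC⟩ := h.abs_inner_normal_le hΩ.isOpen hp
  refine ⟨max C δ⁻¹, fun y hy => ?_⟩
  -- Outside the ball the linear bound `‖y - p‖` is already at most `δ⁻¹ ‖y - p‖²`.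
  by_cases hyb : y ∈ Metric.ball p δ
  · exact (hC y hy hyb).trans (mul_le_mul_of_nonneg_right (le_max_left _ _) (by positivity))
  · have hd : δ ≤ ‖y - p‖ := by simpa [dist_eq_norm] using hyb
    calc |⟪y - p, outwardNormal Ω y⟫| ≤ ‖y - p‖ * ‖outwardNormal Ω y‖ :=
          abs_real_inner_le_norm _ _
      _ = δ⁻¹ * (δ * ‖y - p‖) := by
          rw [(hΩ.isOutwardUnitNormal hy).1, mul_one, inv_mul_cancel_left₀ hδ.ne']
      _ ≤ δ⁻¹ * (‖y - p‖ * ‖y - p‖) := by gcongr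
      _ ≤ max C δ⁻¹ * ‖y - p‖ ^ 2 := by
          rw [← pow_two]
          exact mul_le_mul_of_nonneg_right (le_max_right _ _) (by positivity)

end IsSmoothBoundedDomain

/-! ### Green's formula near the boundary -/

/-- A smooth transition from `0` on `(-∞, 1]` to `1` on `[2, ∞)`. -/
def ramp (τ : ℝ) : ℝ := Real.smoothTransition (τ - 1)

theorem contDiff_ramp : ContDiff ℝ ∞ ramp :=
  Real.smoothTransition.contDiff.comp (contDiff_id.sub contDiff_const)

theorem ramp_of_le_one {τ : ℝ} (h : τ ≤ 1) : ramp τ = 0 :=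
  Real.smoothTransition.zero_of_nonpos (by linarith)

theorem ramp_of_two_le {τ : ℝ} (h : 2 ≤ τ) : ramp τ = 1 :=
  Real.smoothTransition.one_of_one_le (by linarith)

theorem abs_ramp_le_one (τ : ℝ) : |ramp τ| ≤ 1 := by
  rw [ramp, abs_of_nonneg (Real.smoothTransition.nonneg _)]
  exact Real.smoothTransition.le_one _

theorem continuous_deriv_ramp : Continuous (deriv ramp) :=
  contDiff_ramp.continuous_deriv (by simp)

theorem support_deriv_ramp_subset : Function.support (deriv ramp) ⊆ Icc 1 2 := by
  intro τ hτ
  by_contra h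
  rw [mem_Icc, not_and_or, not_le, not_le] at h
  refine hτ ?_
  rcases h with h | h
  · have : ramp =ᶠ[𝓝 τ] fun _ => 0 := by
      filter_upwards [gt_mem_nhds h] with t ht using ramp_of_le_one (le_of_lt ht)
    rw [this.deriv_eq, deriv_const]
  · have : ramp =ᶠ[𝓝 τ] fun _ => 1 := by
      filter_upwards [lt_mem_nhds h] with t ht using ramp_of_two_le (le_of_lt ht)
    rw [this.deriv_eq, deriv_const]

theorem hasCompactSupport_deriv_ramp : HasCompactSupport (deriv ramp) :=
  HasCompactSupport.of_support_subset_isCompact isCompact_Icc support_deriv_ramp_subset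

theorem integral_deriv_ramp : ∫ τ, deriv ramp τ = 1 := by
  have h1 : ∫ τ, deriv ramp τ = ∫ τ in Ioc 1 2, deriv ramp τ := by
    rw [← integral_Icc_eq_integral_Ioc]
    refine (setIntegral_eq_integral_of_forall_compl_eq_zero fun τ hτ => ?_).symm
    by_contra h
    exact hτ (support_deriv_ramp_subset h)
  rw [h1, ← intervalIntegral.integral_of_le one_le_two,
    intervalIntegral.integral_deriv_eq_sub (fun x _ => contDiff_ramp.differentiable (by simp) x)
      (continuous_deriv_ramp.intervalIntegrable _ _), ramp_of_two_le le_rfl, ramp_of_le_one le_rfl,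
    sub_zero]

theorem measurePreserving_coords (L : Plane ≃ₗᵢ[ℝ] Plane) :
    MeasurePreserving (fun q : ℝ × ℝ => L.symm !₂[q.1, q.2]) volume volume := by
  have h1 : MeasurePreserving (MeasurableEquiv.finTwoArrow (α := ℝ)).symm
      (volume : Measure (ℝ × ℝ)) volume := (measurePreserving_finTwoArrow volume).symm
  have h2 : MeasurePreserving (MeasurableEquiv.toLp 2 (Fin 2 → ℝ)) volume volume :=
    (EuclideanSpace.volume_preserving_symm_measurableEquiv_toLp (Fin 2)).symm
  exact L.symm.measurePreserving.comp (h2.comp h1)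

theorem measurableEmbedding_coords (L : Plane ≃ₗᵢ[ℝ] Plane) :
    MeasurableEmbedding (fun q : ℝ × ℝ => L.symm !₂[q.1, q.2]) :=
  L.symm.toHomeomorph.measurableEmbedding.comp
    ((MeasurableEquiv.toLp 2 (Fin 2 → ℝ)).measurableEmbedding.comp
      (MeasurableEquiv.finTwoArrow (α := ℝ)).symm.measurableEmbedding)

theorem integral_comp_sub_mul {E : Type*} [NormedAddCommGroup E] [NormedSpace ℝ E] (F : ℝ → E)
    (a : ℝ) {δ : ℝ} (hδ : 0 < δ) : ∫ t, F t = ∫ τ, δ • F (a - δ * τ) := by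
  rw [integral_smul, Measure.integral_comp_mul_left (fun t => F (a - t)) δ,
    integral_sub_left_eq_self F volume a, smul_smul, abs_inv, abs_of_pos hδ, mul_inv_cancel₀ hδ.ne',
    one_smul]

/-- The weight lives at depths between `δ` and `2δ`. Measuring depth in units of `δ`, by `t = f s -
δ τ`, cancels `δ⁻¹`, and the integrand tends to `ramp'(τ) k` evaluated on the graph. Since `∫ ramp'
= 1`, only the integral along the graph in the parameter `s` survives. -/
theorem IsGraphChart.tendsto_integral_slab {Ω : Set Plane} {p : Plane} {L : Plane ≃ₗᵢ[ℝ] Plane}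
    {f : ℝ → ℝ} {r : ℝ} (h : IsGraphChart Ω p L f r) (hΩ : IsOpen Ω) {k : Plane → Plane}
    (hk : ContinuousOn k (Metric.ball p r ∩ closure Ω)) {K : Set Plane} (hK : IsCompact K)
    (hKb : K ⊆ Metric.ball p r) (hk0 : ∀ x ∉ K, k x = 0) :
    Tendsto (fun δ : ℝ => ∫ x in Ω, (δ⁻¹ * deriv ramp (depth L f x / δ)) • k x) (𝓝[>] 0)
      (𝓝 (∫ s, k (graphPt L f s))) := by
  classical
  -- `k` is controlled only on the closure of `Ω` inside the ball; `κ` is measurable and bounded on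
  -- the whole plane.
  set κ : Plane → Plane := (Metric.ball p r ∩ Ω).indicator k with hκ
  have hBm : MeasurableSet (Metric.ball p r ∩ Ω) := (Metric.isOpen_ball.inter hΩ).measurableSet
  have hκm : Measurable κ := by
    rw [hκ, ← piecewise_eq_indicator]
    exact (hk.mono (inter_subset_inter_right _ subset_closure)).measurable_piecewise
      continuousOn_const hBm
  obtain ⟨C, hC⟩ := (hK.inter_right isClosed_closure).exists_bound_of_continuousOn
    (hk.mono (inter_subset_inter_left _ hKb))
  have hC' : ∀ x, ‖κ x‖ ≤ max C 0 := fun x => by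
    rw [hκ, indicator]
    split_ifs with hx
    · by_cases hxK : x ∈ K
      · exact (hC x ⟨hxK, subset_closure hx.2⟩).trans (le_max_left _ _)
      · simp [hk0 x hxK]
    · simp
  have hκ0 : ∀ x ∉ K, κ x = 0 := fun x hx => by
    rw [hκ, indicator]
    split_ifs
    · exact hk0 x hx
    · rfl
  obtain ⟨R, hR⟩ := continuous_deriv_ramp.bounded_above_of_compact_support
    hasCompactSupport_deriv_ramp
  have hR0 : 0 ≤ R := (norm_nonneg _).trans (hR 0)
  have hdc : Continuous (depth L f) := (contDiff_depth h.contDiff).continuous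
  have hfc : Continuous f := h.contDiff.continuous
  set A : ℝ → ℝ × ℝ → Plane :=
    fun δ q => deriv ramp q.2 • κ (L.symm !₂[q.1, f q.1 - δ * q.2]) with hA
  have hpt : ∀ δ : ℝ, Continuous fun q : ℝ × ℝ => L.symm !₂[q.1, f q.1 - δ * q.2] := fun δ => by
    refine L.symm.continuous.comp ?_
    refine (PiLp.continuous_toLp 2 fun _ : Fin 2 => ℝ).comp (continuous_pi fun i => ?_)
    fin_cases i
    · simpa using continuous_fst
    · have : Continuous fun q : ℝ × ℝ => f q.1 - δ * q.2 := by fun_prop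
      simpa using this
  have hAm : ∀ δ, Measurable (A δ) := fun δ =>
    (continuous_deriv_ramp.measurable.comp measurable_snd).smul (hκm.comp (hpt δ).measurable)
  -- A dominating set independent of `δ`: `κ` vanishes off the ball of radius `r`, which confines
  -- `s`, and `ramp'` vanishes off `[1, 2]`, which confines `τ`.
  set S : Set (ℝ × ℝ) := Icc ((L p) 0 - r) ((L p) 0 + r) ×ˢ Icc 1 2 with hS
  have hSm : MeasurableSet S := measurableSet_Icc.prod measurableSet_Icc
  have hbd : Integrable (S.indicator fun _ => R * max C 0) := by
    rw [integrable_indicator_iff hSm]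
    exact integrableOn_const (isCompact_Icc.prod isCompact_Icc).measure_lt_top.ne
  have hAb : ∀ δ q, ‖A δ q‖ ≤ S.indicator (fun _ => R * max C 0) q := fun δ q => by
    by_cases hq : q ∈ S
    · rw [indicator_of_mem hq, hA, norm_smul]
      exact mul_le_mul (hR _) (hC' _) (norm_nonneg _) hR0
    · rw [indicator_of_notMem hq, norm_le_zero_iff, hA]
      by_contra hne
      rw [← ne_eq, smul_ne_zero_iff] at hne
      refine hq ⟨?_, support_deriv_ramp_subset hne.1⟩
      have hx : L.symm !₂[q.1, f q.1 - δ * q.2] ∈ Metric.ball p r :=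
        hKb (by by_contra hx; exact hne.2 (hκ0 _ hx))
      have h1 : |q.1 - (L p) 0| ≤ ‖!₂[q.1, f q.1 - δ * q.2] - L p‖ := by
        simpa using PiLp.norm_apply_le (!₂[q.1, f q.1 - δ * q.2] - L p) 0
      rw [Metric.mem_ball, dist_eq_norm, ← L.norm_map, map_sub, L.apply_symm_apply] at hx
      have h2 := abs_le.1 (h1.trans hx.le)
      exact ⟨by linarith [h2.1], by linarith [h2.2]⟩
  have hAi : ∀ δ, Integrable (A δ) := fun δ =>
    hbd.mono' (hAm δ).aestronglyMeasurable (Eventually.of_forall (hAb δ))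
  have hlim : Tendsto (fun δ => ∫ q, A δ q) (𝓝[>] 0)
      (𝓝 (∫ q : ℝ × ℝ, deriv ramp q.2 • k (graphPt L f q.1))) := by
    refine tendsto_integral_filter_of_dominated_convergence _
      (Eventually.of_forall fun δ => (hAm δ).aestronglyMeasurable)
      (Eventually.of_forall fun δ => Eventually.of_forall (hAb δ)) hbd
      (Eventually.of_forall fun q => ?_)
    by_cases hq : deriv ramp q.2 = 0
    · simp [hA, hq]
    refine Tendsto.const_smul ?_ _
    -- Where `ramp'` is nonzero, `τ` is positive, so the graph is approached from inside `Ω`; there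
    -- the one-sided continuity of `k` suffices.
    have hτ : 0 < q.2 := by linarith [(support_deriv_ramp_subset hq).1]
    have hpath : Tendsto (fun δ : ℝ => L.symm !₂[q.1, f q.1 - δ * q.2]) (𝓝[>] 0)
        (𝓝 (graphPt L f q.1)) := by
      have hc : Continuous fun δ : ℝ => L.symm !₂[q.1, f q.1 - δ * q.2] := by
        refine L.symm.continuous.comp ?_
        refine (PiLp.continuous_toLp 2 fun _ : Fin 2 => ℝ).comp (continuous_pi fun i => ?_)
        fin_cases i
        · simpa using continuous_const
        · have : Continuous fun δ : ℝ => f q.1 - δ * q.2 := by fun_prop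
          simpa using this
      have := (hc.tendsto 0).mono_left (nhdsWithin_le_nhds (s := Ioi 0))
      simpa [graphPt] using this
    by_cases hb : graphPt L f q.1 ∈ Metric.ball p r
    · have hfr : graphPt L f q.1 ∈ frontier Ω := (h.mem_frontier_iff hΩ hb).2 (by simp)
      have hev : ∀ᶠ δ : ℝ in 𝓝[>] 0,
          L.symm !₂[q.1, f q.1 - δ * q.2] ∈ Metric.ball p r ∩ Ω := by
        filter_upwards [hpath (Metric.isOpen_ball.mem_nhds hb), self_mem_nhdsWithin] with δ hδ hδ0
        refine ⟨hδ, (h.mem_iff _ hδ).2 ?_⟩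
        simpa [depth] using mul_pos hδ0 hτ
      have hcw := hk _ ⟨hb, frontier_subset_closure hfr⟩
      have hpw : Tendsto (fun δ : ℝ => L.symm !₂[q.1, f q.1 - δ * q.2]) (𝓝[>] 0)
          (𝓝[Metric.ball p r ∩ closure Ω] (graphPt L f q.1)) :=
        tendsto_nhdsWithin_iff.2 ⟨hpath, hev.mono fun δ hδ => ⟨hδ.1, subset_closure hδ.2⟩⟩
      refine (hcw.tendsto.comp hpw).congr' ?_
      filter_upwards [hev] with δ hδ
      simp [hκ, indicator_of_mem hδ]
    · have hgK : graphPt L f q.1 ∉ K := fun hg => hb (hKb hg)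
      rw [hk0 _ hgK]
      refine tendsto_const_nhds.congr' ?_
      filter_upwards [hpath (hK.isClosed.isOpen_compl.mem_nhds hgK)] with δ hδ
      exact (hκ0 _ hδ).symm
  have hlim' : ∫ q : ℝ × ℝ, deriv ramp q.2 • k (graphPt L f q.1) = ∫ s, k (graphPt L f s) := by
    have hprod := integral_prod_smul (μ := (volume : Measure ℝ)) (ν := (volume : Measure ℝ))
      (deriv ramp) (fun s => k (graphPt L f s))
    rw [integral_deriv_ramp, one_smul] at hprod
    rw [← hprod, Measure.volume_eq_prod, ← integral_prod_swap]
    rfl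
  rw [hlim'] at hlim
  refine hlim.congr' ?_
  filter_upwards [self_mem_nhdsWithin] with δ hδ
  have hδ : 0 < δ := hδ
  set F : Plane → Plane := fun x => (δ⁻¹ * deriv ramp (depth L f x / δ)) • κ x with hF
  have hFm : Measurable F :=
    ((continuous_const.mul (continuous_deriv_ramp.comp (hdc.div_const δ))).measurable).smul hκm
  have hFi : Integrable F := by
    have hb : Integrable (K.indicator fun _ : Plane => |δ⁻¹| * R * max C 0) := by
      rw [integrable_indicator_iff hK.measurableSet]
      exact integrableOn_const hK.measure_lt_top.ne
    refine hb.mono' hFm.aestronglyMeasurable (Eventually.of_forall fun x => ?_)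
    by_cases hx : x ∈ K
    · rw [indicator_of_mem hx, hF, norm_smul, norm_mul, Real.norm_eq_abs δ⁻¹]
      exact mul_le_mul (mul_le_mul_of_nonneg_left (hR _) (abs_nonneg _)) (hC' _) (norm_nonneg _)
        (by positivity)
    · simp [hF, hκ0 x hx, indicator_of_notMem hx]
  have e1 : ∫ x in Ω, (δ⁻¹ * deriv ramp (depth L f x / δ)) • k x = ∫ x, F x := by
    rw [← integral_indicator hΩ.measurableSet]
    refine integral_congr_ae (Eventually.of_forall fun x => ?_)
    simp only [hF, hκ, indicator]
    by_cases hx : x ∈ Ω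
    · by_cases hb : x ∈ Metric.ball p r
      · simp [hx, hb, mem_inter_iff]
      · simp [hx, hb, mem_inter_iff, hk0 x fun hK' => hb (hKb hK')]
    · simp [hx]
  have hme := measurableEmbedding_coords L
  have hmp := measurePreserving_coords L
  rw [e1, ← hmp.integral_comp hme F, Measure.volume_eq_prod,
    integral_prod _ (hAi δ), integral_prod (fun q : ℝ × ℝ => F (L.symm !₂[q.1, q.2]))
      ((hmp.integrable_comp_emb hme).2 hFi)]
  refine integral_congr_ae (Eventually.of_forall fun s => ?_)
  simp only
  rw [integral_comp_sub_mul (fun t => F (L.symm !₂[s, t])) (f s) hδ]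
  refine integral_congr_ae (Eventually.of_forall fun τ => ?_)
  simp only [hF, hA, smul_smul]
  congr 1
  simp only [depth, LinearIsometryEquiv.apply_symm_apply]
  simp [hδ.ne']

theorem integrable_smul_of_bdd {E : Type*} [NormedAddCommGroup E] [NormedSpace ℝ E]
    [SecondCountableTopology E] {μ : Measure Plane} {u : Plane → ℝ} {v : Plane → E}
    (hu : Integrable u μ) (hv : Continuous v) {C : ℝ} (hC : ∀ x, ‖v x‖ ≤ C) :
    Integrable (fun x => u x • v x) μ := by
  refine (hu.norm.mul_const C).mono' (hu.1.smul hv.aestronglyMeasurable)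
    (Eventually.of_forall fun x => ?_)
  rw [norm_smul]
  exact mul_le_mul_of_nonneg_left (hC x) (norm_nonneg _)

theorem integrable_bdd_smul {E : Type*} [NormedAddCommGroup E] [NormedSpace ℝ E]
    {μ : Measure Plane} {u : Plane → E} {v : Plane → ℝ}
    (hu : Integrable u μ) (hv : Continuous v) {C : ℝ} (hC : ∀ x, ‖v x‖ ≤ C) :
    Integrable (fun x => v x • u x) μ := by
  refine (hu.norm.const_mul C).mono' (hv.aestronglyMeasurable.smul hu.1)
    (Eventually.of_forall fun x => ?_)
  rw [norm_smul]
  exact mul_le_mul_of_nonneg_right (hC x) (norm_nonneg _)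

theorem gradient_comp_real {h : ℝ → ℝ} {d : Plane → ℝ} {x : Plane} {h' : ℝ}
    (hh : HasDerivAt h h' (d x)) (hd : DifferentiableAt ℝ d x) :
    gradient (fun y => h (d y)) x = h' • gradient d x := by
  have := hh.comp_hasFDerivAt x hd.hasFDerivAt
  simp only [gradient_eq_toDual_symm]
  rw [← map_smul, ← this.fderiv]
  rfl

/-- Green's formula for the test function `ψ`. -/
def GreenIdentity (Ω : Set Plane) (φ : Plane → ℝ) (H : Plane → Plane) (ψ : Plane → ℝ) : Prop :=
  ∫ x in Ω, φ x • gradient ψ x =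
    - (∫ x in Ω, ψ x • H x) + ∫ y, (φ y * ψ y) • outwardNormal Ω y ∂(boundaryMeasure Ω)

/-- The weak gradient is tested against `ψ · ramp (depth / δ)`, which has compact support in `Ω`. As
`δ → 0` the ramp tends to `1` inside, and the term containing its derivative is the slab integral.
The non-unit graph normal absorbs the length element. -/
theorem IsGraphChart.greenIdentity {Ω : Set Plane} {p : Plane} {L : Plane ≃ₗᵢ[ℝ] Plane}
    {f : ℝ → ℝ} {r : ℝ} (h : IsGraphChart Ω p L f r) (hΩ : IsOpen Ω) {φ : Plane → ℝ}
    {H : Plane → Plane} (hw : HasWeakGradient Ω φ H) (hφi : IntegrableOn φ Ω)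
    (hHi : IntegrableOn H Ω) (hφ : ContinuousOn φ (Metric.ball p r ∩ closure Ω)) {ψ : Plane → ℝ}
    (hψ : ContDiff ℝ ∞ ψ) (hc : HasCompactSupport ψ) (hs : tsupport ψ ⊆ Metric.ball p r) :
    GreenIdentity Ω φ H ψ := by
  have hd := contDiff_depth (L := L) h.contDiff
  have hg := (contDiff_gradient hψ).continuous
  have hgc := hasCompactSupport_gradient hc
  have hN : Continuous fun x : Plane => graphNormal L f ((L x) 0) :=
    (continuous_graphNormal h.contDiff).comp (contDiff_coord (n := 0) 0).continuous
  have hramp : ∀ δ : ℝ, ContDiff ℝ ∞ fun x => ramp (depth L f x / δ) := fun δ =>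
    contDiff_ramp.comp (hd.div_const δ)
  obtain ⟨C₁, hC₁⟩ := hψ.continuous.bounded_above_of_compact_support hc
  obtain ⟨C₂, hC₂⟩ := hg.bounded_above_of_compact_support hgc
  have hmemΩ : ∀ x ∈ Ω, x ∈ tsupport ψ → Tendsto (fun δ : ℝ => ramp (depth L f x / δ)) (𝓝[>] 0)
      (𝓝 1) := fun x hx hxs => by
    have hpos : 0 < depth L f x := (h.mem_iff x (hs hxs)).1 hx
    refine tendsto_const_nhds.congr' ?_
    filter_upwards [Ioo_mem_nhdsGT (half_pos hpos)] with δ hδ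
    rw [ramp_of_two_le]
    rw [le_div_iff₀ hδ.1]
    linarith [hδ.2]
  have l1 : Tendsto (fun δ : ℝ => ∫ x in Ω, φ x • ramp (depth L f x / δ) • gradient ψ x) (𝓝[>] 0)
      (𝓝 (∫ x in Ω, φ x • gradient ψ x)) := by
    refine tendsto_integral_filter_of_dominated_convergence (fun x => ‖φ x‖ * C₂)
      (Eventually.of_forall fun δ => ?_) (Eventually.of_forall fun δ =>
        Eventually.of_forall fun x => ?_) (hφi.norm.mul_const C₂) ?_
    · exact hφi.1.smul (((hramp δ).continuous.smul hg).aestronglyMeasurable)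
    · rw [norm_smul, norm_smul]
      refine mul_le_mul_of_nonneg_left ?_ (norm_nonneg _)
      calc ‖ramp (depth L f x / δ)‖ * ‖gradient ψ x‖ ≤ 1 * ‖gradient ψ x‖ :=
            mul_le_mul_of_nonneg_right (abs_ramp_le_one _) (norm_nonneg _)
        _ ≤ C₂ := by rw [one_mul]; exact hC₂ x
    · refine (ae_restrict_iff' hΩ.measurableSet).2 (Eventually.of_forall fun x hx => ?_)
      by_cases hxs : x ∈ tsupport ψ
      · simpa using ((hmemΩ x hx hxs).smul_const (gradient ψ x)).const_smul (φ x)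
      · have : gradient ψ x = 0 :=
          image_eq_zero_of_notMem_tsupport fun h => hxs (tsupport_gradient_subset ψ h)
        simp [this]
  have l2 : Tendsto (fun δ : ℝ => ∫ x in Ω, (ψ x * ramp (depth L f x / δ)) • H x) (𝓝[>] 0)
      (𝓝 (∫ x in Ω, ψ x • H x)) := by
    refine tendsto_integral_filter_of_dominated_convergence (fun x => C₁ * ‖H x‖)
      (Eventually.of_forall fun δ => ?_) (Eventually.of_forall fun δ =>
        Eventually.of_forall fun x => ?_) (hHi.norm.const_mul C₁) ?_
    · exact (hψ.continuous.mul (hramp δ).continuous).aestronglyMeasurable.smul hHi.1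
    · rw [norm_smul, norm_mul]
      refine mul_le_mul_of_nonneg_right ?_ (norm_nonneg _)
      calc ‖ψ x‖ * ‖ramp (depth L f x / δ)‖ ≤ ‖ψ x‖ * 1 :=
            mul_le_mul_of_nonneg_left (abs_ramp_le_one _) (norm_nonneg _)
        _ ≤ C₁ := by rw [mul_one]; exact hC₁ x
    · refine (ae_restrict_iff' hΩ.measurableSet).2 (Eventually.of_forall fun x hx => ?_)
      by_cases hxs : x ∈ tsupport ψ
      · simpa using ((hmemΩ x hx hxs).const_mul (ψ x)).smul_const (H x)
      · simp [image_eq_zero_of_notMem_tsupport hxs]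
  have l3 := h.tendsto_integral_slab hΩ
    (k := fun x => (φ x * ψ x) • graphNormal L f ((L x) 0))
    ((hφ.mul hψ.continuous.continuousOn).smul hN.continuousOn) hc hs
    (fun x hx => by simp [image_eq_zero_of_notMem_tsupport hx])
  have hbd : ∫ y, (φ y * ψ y) • outwardNormal Ω y ∂(boundaryMeasure Ω) =
      ∫ s, (φ (graphPt L f s) * ψ (graphPt L f s)) •
        graphNormal L f ((L (graphPt L f s)) 0) := by
    rw [h.setIntegral_boundaryMeasure hΩ (k := fun y => (φ y * ψ y) • outwardNormal Ω y)
      fun x hx => by simp [image_eq_zero_of_notMem_tsupport fun h' => hx (hs h')]]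
    refine integral_congr_ae (Eventually.of_forall fun s => ?_)
    by_cases hb : graphPt L f s ∈ tsupport ψ
    · simp only
      rw [h.outwardNormal_eq (hs hb) (by simp), apply_graphPt_zero, smul_comm,
        smul_inv_smul₀ (norm_graphNormal_pos (L := L) (f := f) s).ne']
    · simp [image_eq_zero_of_notMem_tsupport hb]
  have key : ∀ᶠ δ : ℝ in 𝓝[>] 0,
      (∫ x in Ω, φ x • ramp (depth L f x / δ) • gradient ψ x) =
      -(∫ x in Ω, (ψ x * ramp (depth L f x / δ)) • H x) +
      ∫ x in Ω, (δ⁻¹ * deriv ramp (depth L f x / δ)) • (φ x * ψ x) •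
        graphNormal L f ((L x) 0) := by
    filter_upwards [self_mem_nhdsWithin] with δ hδ
    have hδ : 0 < δ := hδ
    have hT : ContDiff ℝ ∞ fun x => ψ x * ramp (depth L f x / δ) := hψ.mul (hramp δ)
    have hTc : HasCompactSupport fun x => ψ x * ramp (depth L f x / δ) := hc.mul_right
    have hTs : tsupport (fun x => ψ x * ramp (depth L f x / δ)) ⊆ Ω := by
      -- The ramp vanishes at depth below `δ`, so the closed support keeps depth at least `δ` and
      -- cannot touch the boundary.
      have hcl : tsupport (fun x => ψ x * ramp (depth L f x / δ)) ⊆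
          tsupport ψ ∩ {x | δ ≤ depth L f x} := by
        refine closure_minimal (fun x hx => ?_)
          ((isClosed_tsupport ψ).inter (isClosed_le continuous_const hd.continuous))
        have hx' := mul_ne_zero_iff.1 hx
        refine ⟨subset_tsupport _ hx'.1, ?_⟩
        by_contra hlt
        refine hx'.2 (ramp_of_le_one ?_)
        rw [div_le_one hδ]
        exact (not_le.1 hlt).le
      intro x hx
      have hx' := hcl hx
      exact (h.mem_iff x (hs hx'.1)).2 (hδ.trans_le hx'.2)
    have hgr : ∀ x, gradient (fun x => ψ x * ramp (depth L f x / δ)) x =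
        ramp (depth L f x / δ) • gradient ψ x -
          (δ⁻¹ * deriv ramp (depth L f x / δ)) • ψ x • graphNormal L f ((L x) 0) := fun x => by
      have h1 : HasDerivAt (fun t => ramp (t / δ)) (δ⁻¹ * deriv ramp (depth L f x / δ))
          (depth L f x) := by
        have := HasDerivAt.comp (depth L f x)
          (contDiff_ramp.differentiable (by simp) (depth L f x / δ)).hasDerivAt
          ((hasDerivAt_id (depth L f x)).div_const δ)
        simpa [mul_comm, Function.comp_def] using this
      rw [gradient_mul (hψ.differentiable (by simp) x) ((hramp δ).differentiable (by simp) x),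
        gradient_comp_real h1 (hd.differentiable (by simp) x), gradient_depth h.contDiff, smul_neg,
        smul_neg, add_comm, ← sub_eq_add_neg]
      congr 1
      rw [smul_comm]
    have hw' := hw.3 _ hT hTc hTs
    have hr' : Continuous fun x => δ⁻¹ * deriv ramp (depth L f x / δ) :=
      continuous_const.mul (continuous_deriv_ramp.comp (hd.continuous.div_const δ))
    have i1 : IntegrableOn (fun x => φ x • ramp (depth L f x / δ) • gradient ψ x) Ω := by
      obtain ⟨C, hC⟩ := ((hramp δ).continuous.smul hg).bounded_above_of_compact_support
        (HasCompactSupport.smul_left (f := fun x => ramp (depth L f x / δ)) hgc)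
      exact integrable_smul_of_bdd hφi ((hramp δ).continuous.smul hg) hC
    have i3 : IntegrableOn (fun x => φ x • (δ⁻¹ * deriv ramp (depth L f x / δ)) • ψ x •
        graphNormal L f ((L x) 0)) Ω := by
      obtain ⟨C, hC⟩ := (hr'.smul (hψ.continuous.smul hN)).bounded_above_of_compact_support
        (HasCompactSupport.smul_left (f := fun x => δ⁻¹ * deriv ramp (depth L f x / δ))
          (HasCompactSupport.smul_right (f' := fun x => graphNormal L f ((L x) 0)) hc))
      exact integrable_smul_of_bdd hφi (hr'.smul (hψ.continuous.smul hN)) hC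
    simp only [hgr, smul_sub] at hw'
    rw [integral_sub i1 i3] at hw'
    rw [← hw']
    have e3 : ∀ x, (δ⁻¹ * deriv ramp (depth L f x / δ)) • (φ x * ψ x) •
        graphNormal L f ((L x) 0) = φ x • (δ⁻¹ * deriv ramp (depth L f x / δ)) • ψ x •
        graphNormal L f ((L x) 0) := fun x => by
      simp only [smul_smul]
      congr 1
      ring
    simp only [e3, sub_add_cancel]
  rw [GreenIdentity, hbd]
  exact tendsto_nhds_unique (l1.congr' key) (l2.neg.add l3)

theorem GreenIdentity.add {Ω : Set Plane} (hb : Bornology.IsBounded Ω)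
    [IsFiniteMeasure (boundaryMeasure Ω)] (hν : ContinuousOn (outwardNormal Ω) (frontier Ω))
    {φ : Plane → ℝ} {H : Plane → Plane} (hφi : IntegrableOn φ Ω)
    (hHi : IntegrableOn H Ω) (hφ : ContinuousOn φ (frontier Ω)) {ψ₁ ψ₂ : Plane → ℝ}
    (hψ₁ : ContDiff ℝ ∞ ψ₁) (hc₁ : HasCompactSupport ψ₁) (hψ₂ : ContDiff ℝ ∞ ψ₂)
    (hc₂ : HasCompactSupport ψ₂) (h₁ : GreenIdentity Ω φ H ψ₁) (h₂ : GreenIdentity Ω φ H ψ₂) :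
    GreenIdentity Ω φ H (fun x => ψ₁ x + ψ₂ x) := by
  have ia : ∀ ψ : Plane → ℝ, ContDiff ℝ ∞ ψ → HasCompactSupport ψ →
      IntegrableOn (fun x => φ x • gradient ψ x) Ω ∧ IntegrableOn (fun x => ψ x • H x) Ω ∧
      Integrable (fun y => (φ y * ψ y) • outwardNormal Ω y) (boundaryMeasure Ω) := by
    intro ψ hψ hc
    have hg := (contDiff_gradient hψ).continuous
    obtain ⟨C₁, hC₁⟩ := hψ.continuous.bounded_above_of_compact_support hc
    obtain ⟨C₂, hC₂⟩ := hg.bounded_above_of_compact_support (hasCompactSupport_gradient hc)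
    exact ⟨integrable_smul_of_bdd hφi hg hC₂, integrable_bdd_smul hHi hψ.continuous hC₁,
      memLp_one_iff_integrable.1 (memLp_boundaryMeasure_of_continuousOn hb
        ((hφ.mul hψ.continuous.continuousOn).smul hν) 1)⟩
  obtain ⟨a1, a2, a3⟩ := ia ψ₁ hψ₁ hc₁
  obtain ⟨b1, b2, b3⟩ := ia ψ₂ hψ₂ hc₂
  rw [GreenIdentity] at *
  have e : ∀ x, gradient (fun x => ψ₁ x + ψ₂ x) x = gradient ψ₁ x + gradient ψ₂ x := fun x =>
    gradient_add (hψ₁.differentiable (by simp) x) (hψ₂.differentiable (by simp) x)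
  simp only [e, smul_add, mul_add, add_smul]
  rw [integral_add a1 b1, integral_add a2 b2, integral_add a3 b3, h₁, h₂]
  abel

/-- Green's formula on a smooth bounded domain, for a function with integrable weak gradient that is
continuous up to the boundary near the boundary. -/
theorem IsSmoothBoundedDomain.greenIdentity {Ω U : Set Plane} (hΩ : IsSmoothBoundedDomain Ω)
    (hU : IsOpen U) (hfU : frontier Ω ⊆ U) {φ : Plane → ℝ} {H : Plane → Plane}
    (hw : HasWeakGradient Ω φ H) (hφi : IntegrableOn φ Ω) (hHi : IntegrableOn H Ω)
    (hφ : ContinuousOn φ (U ∩ closure Ω)) {ψ : Plane → ℝ} (hψ : ContDiff ℝ ∞ ψ) :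
    GreenIdentity Ω φ H ψ := by
  have := hΩ.isFiniteMeasure_boundaryMeasure
  have hφf : ContinuousOn φ (frontier Ω) :=
    hφ.mono fun x hx => ⟨hfU hx, frontier_subset_closure hx⟩
  have hcpt := hΩ.isBounded.isCompact_closure
  obtain ⟨W, hWo, hW, hgreen⟩ : ∃ W, IsOpen W ∧ closure Ω ⊆ W ∧ ∀ ψ : Plane → ℝ, ContDiff ℝ ∞ ψ →
      HasCompactSupport ψ → tsupport ψ ⊆ W → GreenIdentity Ω φ H ψ := by
    -- Compactness induction replaces a partition of unity: the formula holds near each point of the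
    -- closure and passes to unions.
    refine hcpt.induction_on (p := fun S => ∃ W, IsOpen W ∧ S ⊆ W ∧ ∀ ψ : Plane → ℝ,
      ContDiff ℝ ∞ ψ → HasCompactSupport ψ → tsupport ψ ⊆ W → GreenIdentity Ω φ H ψ) ?_ ?_ ?_ ?_
    · refine ⟨∅, isOpen_empty, subset_rfl, fun ψ _ _ hs => ?_⟩
      have : ψ = 0 := tsupport_eq_empty_iff.1 (subset_empty_iff.1 hs)
      simp [GreenIdentity, this, gradient_eq_toDual_symm]
    · rintro S T hST ⟨W, h1, h2, h3⟩
      exact ⟨W, h1, hST.trans h2, h3⟩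
    · rintro S T ⟨W₁, ho₁, hS, hg₁⟩ ⟨W₂, ho₂, hT, hg₂⟩
      refine ⟨W₁ ∪ W₂, ho₁.union ho₂, union_subset_union hS hT, fun ψ hψ hc hs => ?_⟩
      have hK : IsCompact (tsupport ψ \ W₂) := IsCompact.diff hc ho₂
      -- As `χ = 1` near the part of the support outside `W₂`, the piece `(1 - χ) ψ` is supported in
      -- `W₂`, while `χ ψ` is supported in `W₁`.
      obtain ⟨χ, hχ, hχc, hχs, hχ1⟩ := exists_cutoff hK ho₁ fun x hx =>
        (hs hx.1).resolve_right hx.2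
      have h1 : ContDiff ℝ ∞ fun x => χ x * ψ x := hχ.mul hψ
      have h2 : ContDiff ℝ ∞ fun x => (1 - χ x) * ψ x := (contDiff_const.sub hχ).mul hψ
      have hc2 : HasCompactSupport fun x => (1 - χ x) * ψ x := hc.mul_left
      have g1 := hg₁ _ h1 hχc.mul_right (tsupport_mul_subset_left.trans hχs)
      have g2 := hg₂ _ h2 hc2 fun x hx => by
        by_contra hxW
        have hxψ : x ∈ tsupport ψ := tsupport_mul_subset_right hx
        have hev := hχ1.filter_mono (nhds_le_nhdsSet (show x ∈ tsupport ψ \ W₂ from ⟨hxψ, hxW⟩))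
        refine (notMem_tsupport_iff_eventuallyEq.2 ?_) hx
        filter_upwards [hev] with y hy
        simp [hy]
      have := GreenIdentity.add hΩ.isBounded hΩ.continuousOn_outwardNormal hφi hHi hφf h1
        hχc.mul_right h2 hc2 g1 g2
      convert this using 2 with x
      ring
    · intro p hp
      by_cases hpΩ : p ∈ Ω
      · refine ⟨Ω, mem_nhdsWithin_of_mem_nhds (hΩ.isOpen.mem_nhds hpΩ), Ω, hΩ.isOpen, subset_rfl,
          fun ψ hψ hc hs => ?_⟩
        rw [GreenIdentity, hw.3 ψ hψ hc hs, boundaryMeasure,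
          setIntegral_eq_zero_of_forall_eq_zero (t := frontier Ω), add_zero]
        intro y hy
        have hyΩ : y ∉ Ω := by
          have := hy.2
          rwa [hΩ.isOpen.interior_eq] at this
        simp [image_eq_zero_of_notMem_tsupport fun h => hyΩ (hs h)]
      · have hpf : p ∈ frontier Ω := ⟨hp, by rwa [hΩ.isOpen.interior_eq]⟩
        obtain ⟨L, f, r, h⟩ := hΩ.smooth.exists_isGraphChart hpf
        obtain ⟨r', hr', hrU⟩ := Metric.isOpen_iff.1 hU p (hfU hpf)
        have h' : IsGraphChart Ω p L f (min r r') := ⟨h.contDiff, lt_min h.pos hr', fun x hx =>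
          h.mem_iff x (Metric.ball_subset_ball (min_le_left _ _) hx)⟩
        refine ⟨_, mem_nhdsWithin_of_mem_nhds (Metric.ball_mem_nhds p h'.pos), _,
          Metric.isOpen_ball, subset_rfl, fun ψ hψ hc hs => ?_⟩
        exact h'.greenIdentity hΩ.isOpen hw hφi hHi (hφ.mono (inter_subset_inter_left _
          ((Metric.ball_subset_ball (min_le_right _ _)).trans hrU))) hψ hc hs
  -- The given `ψ` need not have compact support, but only its germ along the closure of `Ω` enters
  -- the formula.
  obtain ⟨χ, hχ, hχc, hχs, hχ1⟩ := exists_cutoff hcpt hWo hW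
  have hg := hgreen (fun x => χ x * ψ x) (hχ.mul hψ) hχc.mul_right
    (tsupport_mul_subset_left.trans hχs)
  have hev : ∀ x ∈ closure Ω, (fun x => χ x * ψ x) =ᶠ[𝓝 x] ψ := fun x hx => by
    filter_upwards [hχ1.filter_mono (nhds_le_nhdsSet hx)] with y hy
    simp [hy]
  rw [GreenIdentity] at *
  have e1 : ∫ x in Ω, φ x • gradient (fun x => χ x * ψ x) x = ∫ x in Ω, φ x • gradient ψ x :=
    setIntegral_congr_fun hΩ.isOpen.measurableSet fun x hx => by
      simp only [(hev x (subset_closure hx)).gradient_eq]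
  have e2 : ∫ x in Ω, (χ x * ψ x) • H x = ∫ x in Ω, ψ x • H x :=
    setIntegral_congr_fun hΩ.isOpen.measurableSet fun x hx => by
      simp only [(hev x (subset_closure hx)).eq_of_nhds]
  have e3 : ∫ y, (φ y * (χ y * ψ y)) • outwardNormal Ω y ∂(boundaryMeasure Ω) =
      ∫ y, (φ y * ψ y) • outwardNormal Ω y ∂(boundaryMeasure Ω) :=
    setIntegral_congr_fun isClosed_frontier.measurableSet fun x hx => by
      simp only [(hev x (frontier_subset_closure hx)).eq_of_nhds]
  rwa [e1, e2, e3] at hg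

/-! ### The regularised pole -/

/-- A regularisation of the kernel `(x - P) / |x - P|²`. -/
def poleField (P : Plane) (ε : ℝ) (x : Plane) : Plane := (‖x - P‖ ^ 2 + ε ^ 2)⁻¹ • (x - P)

/-- The divergence of the regularised kernel. -/
def poleDiv (P : Plane) (ε : ℝ) (x : Plane) : ℝ := 2 * ε ^ 2 / (‖x - P‖ ^ 2 + ε ^ 2) ^ 2

theorem contDiff_normSq_sub (P : Plane) : ContDiff ℝ ∞ fun x : Plane => ‖x - P‖ ^ 2 :=
  (contDiff_id.sub contDiff_const).norm_sq ℝ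

theorem poleDenom_pos (P x : Plane) {ε : ℝ} (hε : 0 < ε) : 0 < ‖x - P‖ ^ 2 + ε ^ 2 := by positivity

theorem contDiff_poleField (P : Plane) {ε : ℝ} (hε : 0 < ε) : ContDiff ℝ ∞ (poleField P ε) :=
  (((contDiff_normSq_sub P).add contDiff_const).inv fun x => (poleDenom_pos P x hε).ne').smul
    (contDiff_id.sub contDiff_const)

theorem continuous_poleDiv (P : Plane) {ε : ℝ} (hε : 0 < ε) : Continuous (poleDiv P ε) :=
  continuous_const.div (((contDiff_normSq_sub P).continuous.add continuous_const).pow 2)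
    fun x => (pow_pos (poleDenom_pos P x hε) 2).ne'

theorem fderiv_poleField_coord (P x v : Plane) {ε : ℝ} (hε : 0 < ε) (i : Fin 2) :
    fderiv ℝ (fun y => poleField P ε y i) x v =
      (‖x - P‖ ^ 2 + ε ^ 2)⁻¹ * v i -
        2 * ⟪x - P, v⟫ / (‖x - P‖ ^ 2 + ε ^ 2) ^ 2 * (x - P) i := by
  have hD := (poleDenom_pos P x hε).ne'
  have h1 : HasFDerivAt (fun y : Plane => y - P) (ContinuousLinearMap.id ℝ Plane) x :=
    (hasFDerivAt_id x).sub_const P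
  have h2 := (hasDerivAt_inv hD).comp_hasFDerivAt x (h1.norm_sq.add_const (ε ^ 2))
  have h3 := (h2.smul h1)
  have h4 : HasFDerivAt (fun y => poleField P ε y i) _ x :=
    (EuclideanSpace.proj (𝕜 := ℝ) i).hasFDerivAt.comp x h3
  rw [h4.fderiv, inner_sub_left]
  simp
  ring

/-- With `d = ‖x - P‖² + ε²`, the divergence in dimension two is `2/d - 2‖x - P‖²/d² = 2ε²/d²`. -/
theorem sum_inner_gradient_poleField (P x : Plane) {ε : ℝ} (hε : 0 < ε) :
    ∑ i : Fin 2, ⟪gradient (fun y => poleField P ε y i) x, EuclideanSpace.single i 1⟫ =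
      poleDiv P ε x := by
  simp only [inner_gradient_left, fderiv_poleField_coord P x _ hε]
  have hD := (poleDenom_pos P x hε).ne'
  have hn : ‖x - P‖ ^ 2 = (x - P) 0 ^ 2 + (x - P) 1 ^ 2 := by
    rw [EuclideanSpace.norm_sq_eq]
    simp [Fin.sum_univ_two]
  simp only [Fin.sum_univ_two, EuclideanSpace.inner_single_right, poleDiv]
  simp only [PiLp.single_apply, if_true, one_mul, mul_one, conj_trivial]
  field_simp
  rw [hn]
  ring

/-- `GreenIdentity` is vector valued. Taking its `i`-th component for the test function `poleField P
ε · i` and summing over `i` gives the divergence theorem for the field. -/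
theorem green_poleField {Ω : Set Plane} (hΩ : IsSmoothBoundedDomain Ω) {φ : Plane → ℝ}
    {H : Plane → Plane} (hφi : IntegrableOn φ Ω) (hHi : IntegrableOn H Ω)
    (hφ : ContinuousOn φ (frontier Ω))
    (hg : ∀ ψ : Plane → ℝ, ContDiff ℝ ∞ ψ → GreenIdentity Ω φ H ψ) (P : Plane) {ε : ℝ}
    (hε : 0 < ε) :
    ∫ x in Ω, φ x * poleDiv P ε x = - (∫ x in Ω, ⟪poleField P ε x, H x⟫) +
      ∫ y, φ y * ⟪poleField P ε y, outwardNormal Ω y⟫ ∂(boundaryMeasure Ω) := by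
  have := hΩ.isFiniteMeasure_boundaryMeasure
  have hcd : ∀ i : Fin 2, ContDiff ℝ ∞ fun y => poleField P ε y i :=
    contDiff_euclidean.1 (contDiff_poleField P hε)
  have bdd : ∀ {E : Type} [NormedAddCommGroup E] (v : Plane → E), Continuous v →
      ∃ C, ∀ x ∈ closure Ω, ‖v x‖ ≤ C := fun v hv =>
    hΩ.isBounded.isCompact_closure.exists_bound_of_continuousOn hv.continuousOn
  have i1 : ∀ i : Fin 2, IntegrableOn
      (fun x => φ x • gradient (fun y => poleField P ε y i) x) Ω := fun i => by
    have hc := (contDiff_gradient (hcd i)).continuous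
    obtain ⟨C, hC⟩ := bdd _ hc
    refine (hφi.norm.mul_const C).mono' (hφi.1.smul hc.aestronglyMeasurable) ?_
    refine (ae_restrict_iff' hΩ.isOpen.measurableSet).2 (Eventually.of_forall fun x hx => ?_)
    rw [norm_smul]
    exact mul_le_mul_of_nonneg_left (hC x (subset_closure hx)) (norm_nonneg _)
  have i2 : ∀ i : Fin 2, IntegrableOn (fun x => poleField P ε x i • H x) Ω := fun i => by
    have hc := (hcd i).continuous
    obtain ⟨C, hC⟩ := bdd _ hc
    refine (hHi.norm.const_mul C).mono' (hc.aestronglyMeasurable.smul hHi.1) ?_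
    refine (ae_restrict_iff' hΩ.isOpen.measurableSet).2 (Eventually.of_forall fun x hx => ?_)
    rw [norm_smul]
    exact mul_le_mul_of_nonneg_right (hC x (subset_closure hx)) (norm_nonneg _)
  have i3 : ∀ i : Fin 2, Integrable
      (fun y => (φ y * poleField P ε y i) • outwardNormal Ω y) (boundaryMeasure Ω) := fun i =>
    memLp_one_iff_integrable.1 (memLp_boundaryMeasure_of_continuousOn hΩ.isBounded
      ((hφ.mul (hcd i).continuous.continuousOn).smul hΩ.continuousOn_outwardNormal) 1)
  have hi : ∀ i : Fin 2,
      ∫ x in Ω, ⟪(EuclideanSpace.single i 1 : Plane),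
        φ x • gradient (fun y => poleField P ε y i) x⟫ =
      -(∫ x in Ω, ⟪(EuclideanSpace.single i 1 : Plane), poleField P ε x i • H x⟫) +
      ∫ y, ⟪(EuclideanSpace.single i 1 : Plane),
        (φ y * poleField P ε y i) • outwardNormal Ω y⟫ ∂(boundaryMeasure Ω) := fun i => by
    rw [integral_inner (i1 i), integral_inner (i2 i), integral_inner (i3 i), ← inner_neg_right,
      ← inner_add_right]
    exact congrArg _ (hg _ (hcd i))
  have hsum := congrArg₂ (· + ·) (hi 0) (hi 1)
  simp only at hsum
  rw [← integral_add ((i1 0).const_inner _) ((i1 1).const_inner _)] at hsum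
  have a1 : ∀ x, ⟪(EuclideanSpace.single 0 1 : Plane),
        φ x • gradient (fun y => poleField P ε y 0) x⟫ + ⟪(EuclideanSpace.single 1 1 : Plane),
        φ x • gradient (fun y => poleField P ε y 1) x⟫ = φ x * poleDiv P ε x := fun x => by
    rw [← sum_inner_gradient_poleField P x hε, Fin.sum_univ_two, real_inner_smul_right,
      real_inner_smul_right, real_inner_comm, real_inner_comm (gradient _ x), mul_add]
  have a2 : ∀ x, ⟪poleField P ε x, H x⟫ =
      ⟪(EuclideanSpace.single 0 1 : Plane), poleField P ε x 0 • H x⟫ +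
      ⟪(EuclideanSpace.single 1 1 : Plane), poleField P ε x 1 • H x⟫ := fun x => by
    simp [PiLp.inner_apply, Fin.sum_univ_two, mul_comm]
  have a3 : ∀ y, φ y * ⟪poleField P ε y, outwardNormal Ω y⟫ =
      ⟪(EuclideanSpace.single 0 1 : Plane), (φ y * poleField P ε y 0) • outwardNormal Ω y⟫ +
      ⟪(EuclideanSpace.single 1 1 : Plane), (φ y * poleField P ε y 1) • outwardNormal Ω y⟫ :=
    fun y => by
    simp [PiLp.inner_apply, Fin.sum_univ_two]
    ring
  simp only [a1] at hsum
  simp only [a2, a3]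
  rw [hsum, integral_add ((i2 0).const_inner _) ((i2 1).const_inner _),
    integral_add ((i3 0).const_inner _) ((i3 1).const_inner _)]
  ring

/-! ### Radial integrals -/

theorem volume_real_unit_ball : (volume : Measure Plane).real (Metric.ball 0 1) = Real.pi := by
  rw [Measure.real, EuclideanSpace.volume_ball_fin_two]
  simp [Real.pi_pos.le]

/-- The antiderivative of the radial profile times the polar Jacobian `y`; it rises from `-1` at `0`
to `0` at infinity. -/
theorem hasDerivAt_neg_inv_one_add_sq (y : ℝ) :
    HasDerivAt (fun y : ℝ => -(y ^ 2 + 1)⁻¹) (y * (2 / (y ^ 2 + 1) ^ 2)) y := by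
  have h0 : y ^ 2 + 1 ≠ 0 := by positivity
  have h1 : HasDerivAt (fun y : ℝ => y ^ 2 + 1) (2 * y) y := by
    simpa using ((hasDerivAt_id y).pow 2).add_const (1 : ℝ)
  refine (h1.fun_inv h0).neg.congr_deriv ?_
  field_simp

theorem tendsto_neg_inv_one_add_sq :
    Tendsto (fun y : ℝ => -(y ^ 2 + 1)⁻¹) atTop (𝓝 0) := by
  have : Tendsto (fun y : ℝ => y ^ 2 + 1) atTop atTop :=
    tendsto_atTop_add_const_right _ _ (tendsto_pow_atTop two_ne_zero)
  simpa using this.inv_tendsto_atTop.neg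

theorem integrable_poleProfile : Integrable fun y : Plane => 2 / (‖y‖ ^ 2 + 1) ^ 2 := by
  rw [integrable_fun_norm_addHaar volume (f := fun r : ℝ => 2 / (r ^ 2 + 1) ^ 2)]
  simp only [finrank_euclideanSpace, Fintype.card_fin, smul_eq_mul]
  norm_num
  exact integrableOn_Ioi_deriv_of_nonneg' (fun y _ => hasDerivAt_neg_inv_one_add_sq y)
    (fun y hy => mul_nonneg (le_of_lt hy) (by positivity)) tendsto_neg_inv_one_add_sq

theorem integral_poleProfile : ∫ y : Plane, 2 / (‖y‖ ^ 2 + 1) ^ 2 = 2 * Real.pi := by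
  rw [integral_fun_norm_addHaar volume (fun r : ℝ => 2 / (r ^ 2 + 1) ^ 2), volume_real_unit_ball]
  have h := integral_Ioi_of_hasDerivAt_of_nonneg'
    (fun y (_ : y ∈ Ici (0 : ℝ)) => hasDerivAt_neg_inv_one_add_sq y)
    (fun y hy => mul_nonneg (le_of_lt hy) (by positivity)) tendsto_neg_inv_one_add_sq
  simp only [finrank_euclideanSpace, Fintype.card_fin, smul_eq_mul]
  norm_num at h ⊢
  exact h

/-- In polar coordinates the Jacobian `r` cancels the singularity `r⁻¹`. -/
theorem integrable_indicator_ball_inv_norm (P : Plane) (r : ℝ) :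
    IntegrableOn (fun x : Plane => ‖x - P‖⁻¹) (Metric.ball P r) := by
  have h : Integrable fun x : Plane => (Iio r).indicator (fun t : ℝ => t⁻¹) ‖x‖ := by
    rw [integrable_fun_norm_addHaar volume]
    simp only [finrank_euclideanSpace, Fintype.card_fin, smul_eq_mul]
    norm_num
    have h1 : IntegrableOn (fun _ : ℝ => (1 : ℝ)) (Ioo 0 r) :=
      integrableOn_const (by simp)
    have h2 := (integrable_indicator_iff measurableSet_Ioo).2 h1
    refine h2.integrableOn.congr_fun (fun y hy => ?_) measurableSet_Ioi
    have hy : 0 < y := hy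
    by_cases hyr : y < r
    · simp [indicator, hyr, hy, hy.ne']
    · simp [indicator, hyr]
  rw [← integrable_indicator_iff Metric.isOpen_ball.measurableSet]
  refine (h.comp_sub_right P).congr (Eventually.of_forall fun x => ?_)
  simp [indicator, dist_eq_norm]

theorem ae_inner_ne_zero {n : Plane} (hn : n ≠ 0) : ∀ᵐ y : Plane, ⟪y, n⟫ ≠ 0 := by
  have h := Measure.addHaar_submodule (volume : Measure Plane) (ℝ ∙ n)ᗮ fun htop => hn (by
    have : n ∈ (ℝ ∙ n)ᗮ := by rw [htop]; trivial
    exact inner_self_eq_zero.1 (Submodule.mem_orthogonal_singleton_iff_inner_right.1 this))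
  rw [ae_iff]
  convert h using 2
  ext y
  simp [Submodule.mem_orthogonal_singleton_iff_inner_left]

/-- The reflection `y ↦ -y` exchanges the two open half-planes, and the line between them is null.
-/
theorem integral_halfPlane_even {n : Plane} (hn : n ≠ 0) {k : Plane → ℝ} (hk : Integrable k)
    (hev : ∀ y, k (-y) = k y) : 2 * ∫ y in {y : Plane | ⟪y, n⟫ < 0}, k y = ∫ y, k y := by
  have hm : MeasurableSet {y : Plane | ⟪y, n⟫ < 0} :=
    (isOpen_lt (continuous_id.inner continuous_const) continuous_const).measurableSet
  have hi := hk.indicator hm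
  have e : ∫ y, {y : Plane | ⟪y, n⟫ < 0}.indicator k y =
      ∫ y, {y : Plane | ⟪y, n⟫ < 0}.indicator k (-y) := (integral_neg_eq_self _ _).symm
  rw [← integral_indicator hm, two_mul]
  nth_rewrite 2 [e]
  rw [← integral_add hi hi.comp_neg]
  refine integral_congr_ae ?_
  filter_upwards [ae_inner_ne_zero hn] with y hy
  rcases lt_or_gt_of_ne hy with h | h
  · simp [indicator, h, not_lt.2 h.le]
  · simp [indicator, h, not_lt.2 h.le, hev]

/-! ### Concentration of the regularised pole at a boundary point -/

theorem integral_comp_add_smul (P : Plane) {ε : ℝ} (hε : 0 < ε) (F : Plane → ℝ) :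
    ∫ x, F x = ∫ y, ε ^ 2 * F (P + ε • y) := by
  rw [integral_const_mul, Measure.integral_comp_smul volume (fun y => F (P + y)) ε,
    integral_add_left_eq_self]
  simp only [finrank_euclideanSpace, Fintype.card_fin, smul_eq_mul]
  rw [abs_of_pos (by positivity), mul_inv_cancel_left₀ (by positivity)]

/-- `poleDiv` is an approximate identity of total mass `2π`. Seen from `P` at scale `ε` the domain
looks like the half-plane `⟪y, n⟫ < 0`, which receives half of that mass. -/
theorem tendsto_integral_poleDiv {Ω U : Set Plane} (hΩ : IsOpen Ω) {P n : Plane}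
    (hn : IsOutwardUnitNormal Ω P n) (hP : P ∈ closure Ω) (hU : IsOpen U) (hPU : P ∈ U)
    {φ : Plane → ℝ} (hφi : IntegrableOn φ Ω) (hφ : ContinuousOn φ (U ∩ closure Ω)) :
    Tendsto (fun ε : ℝ => ∫ x in Ω, φ x * poleDiv P ε x) (𝓝[>] 0) (𝓝 (Real.pi * φ P)) := by
  classical
  obtain ⟨r, hr, hrU, hrb⟩ : ∃ r > 0, Metric.ball P r ⊆ U ∧
      ∀ x ∈ Metric.ball P r ∩ Ω, ‖φ x‖ ≤ ‖φ P‖ + 1 := by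
    obtain ⟨r₁, hr₁, h₁⟩ := Metric.isOpen_iff.1 hU P hPU
    have hc := (hφ P ⟨hPU, hP⟩).norm
    have hev := (tendsto_order.1 hc.tendsto).2 (‖φ P‖ + 1) (by linarith)
    obtain ⟨r₂, hr₂, h₂⟩ := Metric.mem_nhdsWithin_iff.1 hev
    refine ⟨min r₁ r₂, lt_min hr₁ hr₂, (Metric.ball_subset_ball (min_le_left _ _)).trans h₁,
      fun x hx => le_of_lt (h₂ ⟨Metric.ball_subset_ball (min_le_right _ _) hx.1,
        h₁ (Metric.ball_subset_ball (min_le_left _ _) hx.1), subset_closure hx.2⟩)⟩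
  set B := Metric.ball P r with hB
  have hBm : MeasurableSet B := Metric.isOpen_ball.measurableSet
  have hBΩ : MeasurableSet (B ∩ Ω) := (Metric.isOpen_ball.inter hΩ).measurableSet
  set κ : Plane → ℝ := (B ∩ Ω).indicator φ with hκ
  have hκm : Measurable κ := by
    rw [hκ, ← piecewise_eq_indicator]
    exact (hφ.mono fun x hx => ⟨hrU hx.1, subset_closure hx.2⟩).measurable_piecewise
      continuousOn_const hBΩ
  have hκb : ∀ x, ‖κ x‖ ≤ ‖φ P‖ + 1 := fun x => by
    rw [hκ, indicator]
    split_ifs with hx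
    · exact hrb x hx
    · rw [norm_zero]
      positivity
  -- At distance at least `r` from `P` the divergence is `O(ε²)`.
  have hfar : Tendsto (fun ε : ℝ => ∫ x in Ω \ B, φ x * poleDiv P ε x) (𝓝[>] 0) (𝓝 0) := by
    suffices h : Tendsto (fun ε : ℝ => ∫ x in Ω \ B, φ x * poleDiv P ε x) (𝓝[>] 0)
        (𝓝 (∫ _ in Ω \ B, (0 : ℝ))) by simpa using h
    have hm : ∀ᵐ x ∂volume.restrict (Ω \ B), r ≤ ‖x - P‖ :=
      (ae_restrict_iff' (hΩ.measurableSet.diff hBm)).2 (Eventually.of_forall fun x hx => by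
        have := hx.2
        rw [hB, Metric.mem_ball, not_lt, dist_eq_norm] at this
        exact this)
    refine tendsto_integral_filter_of_dominated_convergence (fun x => ‖φ x‖ * (2 / r ^ 4)) ?_ ?_
      ((hφi.mono_set sdiff_subset).norm.mul_const _) ?_
    · filter_upwards [self_mem_nhdsWithin] with ε hε
      exact (hφi.mono_set sdiff_subset).1.mul (continuous_poleDiv P hε).aestronglyMeasurable
    · filter_upwards [Ioo_mem_nhdsGT (zero_lt_one' ℝ)] with ε hε
      filter_upwards [hm] with x hx
      rw [norm_mul]
      refine mul_le_mul_of_nonneg_left ?_ (norm_nonneg _)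
      have h1 : r ^ 4 ≤ (‖x - P‖ ^ 2 + ε ^ 2) ^ 2 := by
        have : r ^ 2 ≤ ‖x - P‖ ^ 2 + ε ^ 2 := by
          have := pow_le_pow_left₀ hr.le hx 2
          nlinarith [sq_nonneg ε]
        calc r ^ 4 = (r ^ 2) ^ 2 := by ring
          _ ≤ _ := pow_le_pow_left₀ (by positivity) this 2
      rw [poleDiv, Real.norm_of_nonneg (by positivity)]
      exact div_le_div₀ (by norm_num) (by nlinarith [hε.1, hε.2]) (by positivity) h1
    · filter_upwards [hm] with x hx
      have hx0 : ‖x - P‖ ≠ 0 := (hr.trans_le hx).ne'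
      have hc : ContinuousAt (fun ε : ℝ => φ x * poleDiv P ε x) 0 := by
        unfold poleDiv
        refine continuousAt_const.mul (ContinuousAt.div (by fun_prop) (by fun_prop) ?_)
        simpa using hx0
      have := hc.tendsto.mono_left (nhdsWithin_le_nhds (s := Ioi 0))
      simpa [poleDiv] using this
  have hnear : Tendsto (fun ε : ℝ => ∫ x in Ω ∩ B, φ x * poleDiv P ε x) (𝓝[>] 0)
      (𝓝 (Real.pi * φ P)) := by
    -- Under `x = P + ε y` the factor `ε² · poleDiv` becomes the fixed profile. The two ray
    -- conditions defining the outward normal give the pointwise limit of `κ (P + ε • y)` for every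
    -- `y` off the tangent line.
    have hlim : Tendsto (fun ε : ℝ => ∫ y, κ (P + ε • y) * (2 / (‖y‖ ^ 2 + 1) ^ 2)) (𝓝[>] 0)
        (𝓝 (∫ y, {y : Plane | ⟪y, n⟫ < 0}.indicator
          (fun y => φ P * (2 / (‖y‖ ^ 2 + 1) ^ 2)) y)) := by
      refine tendsto_integral_filter_of_dominated_convergence
        (fun y => (‖φ P‖ + 1) * (2 / (‖y‖ ^ 2 + 1) ^ 2)) (Eventually.of_forall fun ε => ?_)
        (Eventually.of_forall fun ε => Eventually.of_forall fun y => ?_)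
        (integrable_poleProfile.const_mul _) ?_
      · have hc : Continuous fun y : Plane => P + ε • y := by fun_prop
        exact (hκm.comp hc.measurable).aestronglyMeasurable.mul integrable_poleProfile.1
      · rw [norm_mul, Real.norm_of_nonneg (by positivity : 0 ≤ 2 / (‖y‖ ^ 2 + 1) ^ 2)]
        exact mul_le_mul_of_nonneg_right (hκb _) (by positivity)
      · have hn0 : n ≠ 0 := fun h => by simpa [h] using hn.1
        filter_upwards [ae_inner_ne_zero hn0] with y hy
        have hpath : Tendsto (fun ε : ℝ => P + ε • y) (𝓝[>] 0) (𝓝 P) := by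
          have hc : Continuous fun ε : ℝ => P + ε • y := by fun_prop
          simpa using (hc.tendsto 0).mono_left (nhdsWithin_le_nhds (s := Ioi 0))
        rcases lt_or_gt_of_ne hy with h | h
        · rw [indicator_of_mem (show y ∈ {y : Plane | ⟪y, n⟫ < 0} from h)]
          refine Tendsto.mul_const _ ?_
          have hev : ∀ᶠ ε : ℝ in 𝓝[>] 0, P + ε • y ∈ B ∩ Ω :=
            (hpath.eventually (Metric.ball_mem_nhds P hr)).and (hn.2.1 y h)
          have hpw : Tendsto (fun ε : ℝ => P + ε • y) (𝓝[>] 0) (𝓝[U ∩ closure Ω] P) :=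
            tendsto_nhdsWithin_iff.2 ⟨hpath, hev.mono fun ε hε =>
              ⟨hrU hε.1, subset_closure hε.2⟩⟩
          refine ((hφ P ⟨hPU, hP⟩).tendsto.comp hpw).congr' ?_
          filter_upwards [hev] with ε hε
          simp [hκ, indicator_of_mem hε]
        · rw [indicator_of_notMem (show y ∉ {y : Plane | ⟪y, n⟫ < 0} from not_lt.2 (le_of_lt h))]
          refine tendsto_const_nhds.congr' ?_
          filter_upwards [hn.2.2 y h] with ε hε
          rw [hκ, indicator_of_notMem fun h' => hε (subset_closure h'.2), zero_mul]
    have hval : ∫ y, {y : Plane | ⟪y, n⟫ < 0}.indicator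
        (fun y => φ P * (2 / (‖y‖ ^ 2 + 1) ^ 2)) y = Real.pi * φ P := by
      have hm : MeasurableSet {y : Plane | ⟪y, n⟫ < 0} :=
        (isOpen_lt (continuous_id.inner continuous_const) continuous_const).measurableSet
      have hn0 : n ≠ 0 := fun h => by simpa [h] using hn.1
      have h2 := integral_halfPlane_even hn0 integrable_poleProfile (fun y => by rw [norm_neg])
      rw [integral_poleProfile] at h2
      rw [integral_indicator hm, integral_const_mul]
      linear_combination (φ P / 2) * h2
    rw [hval] at hlim
    refine hlim.congr' ?_
    filter_upwards [self_mem_nhdsWithin] with ε hε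
    have hε : 0 < ε := hε
    rw [inter_comm, ← integral_indicator hBΩ, integral_comp_add_smul P hε
      ((B ∩ Ω).indicator fun x => φ x * poleDiv P ε x)]
    refine integral_congr_ae (Eventually.of_forall fun y => ?_)
    have e1 : (B ∩ Ω).indicator (fun x => φ x * poleDiv P ε x) (P + ε • y) =
        κ (P + ε • y) * poleDiv P ε (P + ε • y) := by
      simp only [hκ, indicator]
      split_ifs <;> simp
    simp only
    rw [e1, poleDiv, add_sub_cancel_left, norm_smul, Real.norm_of_nonneg hε.le]
    field_simp
  have := hnear.add hfar
  rw [add_zero] at this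
  refine this.congr' ?_
  filter_upwards [self_mem_nhdsWithin] with ε hε
  refine integral_inter_add_sdiff hBm ?_
  have hε : 0 < ε := hε
  refine (hφi.norm.mul_const (2 * ε ^ 2 / (ε ^ 2) ^ 2)).mono'
    (hφi.1.mul (continuous_poleDiv P hε).aestronglyMeasurable) (Eventually.of_forall fun x => ?_)
  rw [norm_mul]
  refine mul_le_mul_of_nonneg_left ?_ (norm_nonneg _)
  rw [poleDiv, Real.norm_of_nonneg (by positivity)]
  gcongr
  linarith [sq_nonneg ‖x - P‖]

/-! ### Green's formula with a pole on the boundary -/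

theorem poleField_zero (P x : Plane) : poleField P 0 x = (1 / ‖x - P‖ ^ 2) • (x - P) := by
  simp [poleField]

theorem norm_poleField_le (P : Plane) (ε : ℝ) (x : Plane) : ‖poleField P ε x‖ ≤ ‖x - P‖⁻¹ := by
  by_cases hx : x - P = 0
  · simp [poleField, hx]
  have hpos : 0 < ‖x - P‖ := norm_pos_iff.2 hx
  rw [poleField, norm_smul, norm_inv, Real.norm_of_nonneg (by positivity)]
  calc (‖x - P‖ ^ 2 + ε ^ 2)⁻¹ * ‖x - P‖ ≤ (‖x - P‖ ^ 2)⁻¹ * ‖x - P‖ := by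
        gcongr
        linarith [sq_nonneg ε]
    _ = ‖x - P‖⁻¹ := by field_simp

theorem tendsto_poleField (P x : Plane) :
    Tendsto (fun ε : ℝ => poleField P ε x) (𝓝[>] 0) (𝓝 (poleField P 0 x)) := by
  by_cases hx : x - P = 0
  · simp [poleField, hx]
  have hpos : ‖x - P‖ ≠ 0 := norm_ne_zero_iff.2 hx
  have hc : ContinuousAt (fun ε : ℝ => poleField P ε x) 0 := by
    unfold poleField
    have h1 : ContinuousAt (fun ε : ℝ => ‖x - P‖ ^ 2 + ε ^ 2) 0 := by fun_prop
    exact (h1.inv₀ (by simpa using hpos)).smul continuousAt_const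
  exact hc.tendsto.mono_left nhdsWithin_le_nhds

theorem measurable_poleField_zero (P : Plane) : Measurable (poleField P 0) :=
  (((contDiff_normSq_sub P).continuous.add continuous_const).measurable.inv).smul
    (measurable_id.sub_const P)

/-- Near `P` the weight is integrable and `H` bounded; away from `P` the weight is bounded and `H`
integrable. -/
theorem integrableOn_inv_norm_mul {Ω : Set Plane} {H : Plane → Plane}
    (hHi : IntegrableOn H Ω) {P : Plane} {C r : ℝ} (hr : 0 < r)
    (hb : ∀ᵐ x ∂volume.restrict (Ω ∩ Metric.ball P r), ‖H x‖ ≤ C) :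
    IntegrableOn (fun x => ‖x - P‖⁻¹ * ‖H x‖) Ω := by
  have hBm : MeasurableSet (Metric.ball P r) := Metric.isOpen_ball.measurableSet
  have hm : Measurable fun x : Plane => ‖x - P‖⁻¹ := (measurable_id.sub_const P).norm.inv
  rw [← inter_union_sdiff Ω (Metric.ball P r)]
  refine IntegrableOn.union ?_ ?_
  · have h1 := ((integrable_indicator_ball_inv_norm P r).mono_set
      (inter_subset_right (s := Ω))).mul_const C
    refine h1.mono' (hm.aestronglyMeasurable.mul (hHi.mono_set inter_subset_left).1.norm) ?_
    filter_upwards [hb] with x hx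
    rw [Real.norm_of_nonneg (by positivity)]
    exact mul_le_mul_of_nonneg_left hx (by positivity)
  · have h1 := (hHi.mono_set (sdiff_subset (t := Metric.ball P r))).norm.const_mul r⁻¹
    refine h1.mono' (hm.aestronglyMeasurable.mul (hHi.mono_set sdiff_subset).1.norm) ?_
    have hae : ∀ᵐ x ∂volume.restrict (Ω \ Metric.ball P r), x ∉ Metric.ball P r := by
      refine ae_restrict_of_ae_restrict_of_subset (t := (Metric.ball P r)ᶜ) (fun x hx => hx.2) ?_
      exact (ae_restrict_iff' hBm.compl).2 (Eventually.of_forall fun x hx => hx)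
    filter_upwards [hae] with x hx
    rw [Metric.mem_ball, not_lt, dist_eq_norm] at hx
    rw [Real.norm_of_nonneg (by positivity)]
    gcongr

/-- Green's formula for the kernel `(x - P) / |x - P|²` with pole `P` on the boundary. -/
theorem green_pole {Ω U : Set Plane} (hΩ : IsSmoothBoundedDomain Ω) (hU : IsOpen U)
    (hfU : frontier Ω ⊆ U) {φ : Plane → ℝ} {H : Plane → Plane} (hw : HasWeakGradient Ω φ H)
    (hφi : IntegrableOn φ Ω) (hHi : IntegrableOn H Ω) (hφ : ContinuousOn φ (U ∩ closure Ω))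
    {P : Plane} (hP : P ∈ frontier Ω)
    (hi : IntegrableOn (fun x => ‖x - P‖⁻¹ * ‖H x‖) Ω) :
    IntegrableOn (fun x => ⟪poleField P 0 x, H x⟫) Ω ∧
    Integrable (fun y => φ y * ⟪poleField P 0 y, outwardNormal Ω y⟫) (boundaryMeasure Ω) ∧
    ∫ x in Ω, ⟪poleField P 0 x, H x⟫ =
      (∫ y, φ y * ⟪poleField P 0 y, outwardNormal Ω y⟫ ∂(boundaryMeasure Ω)) - Real.pi * φ P := by
  have := hΩ.isFiniteMeasure_boundaryMeasure
  have hφf : ContinuousOn φ (frontier Ω) :=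
    hφ.mono fun x hx => ⟨hfU hx, frontier_subset_closure hx⟩
  have hφb := memLp_one_iff_integrable.1 (memLp_boundaryMeasure_of_continuousOn hΩ.isBounded hφf 1)
  have hν := (memLp_one_iff_integrable.1 (memLp_boundaryMeasure_of_continuousOn hΩ.isBounded
    hΩ.continuousOn_outwardNormal 1)).1
  obtain ⟨C, hC⟩ := hΩ.exists_abs_inner_normal_le hP
  have hb1 : ∀ (ε : ℝ) (x : Plane), ‖⟪poleField P ε x, H x⟫‖ ≤ ‖x - P‖⁻¹ * ‖H x‖ := fun ε x =>
    (norm_inner_le_norm _ _).trans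
      (mul_le_mul_of_nonneg_right (norm_poleField_le P ε x) (norm_nonneg _))
  -- The quadratic tangency of the boundary to its tangent line at `P` bounds the flux uniformly in
  -- `ε`.
  have hb2 : ∀ ε : ℝ, ∀ᵐ y ∂boundaryMeasure Ω,
      ‖φ y * ⟪poleField P ε y, outwardNormal Ω y⟫‖ ≤ ‖φ y‖ * max C 0 := fun ε => by
    refine (ae_restrict_iff' isClosed_frontier.measurableSet).2 (Eventually.of_forall fun y hy => ?_)
    rw [norm_mul]
    refine mul_le_mul_of_nonneg_left ?_ (norm_nonneg _)
    by_cases hyP : y - P = 0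
    · simp [poleField, hyP]
    have hpos : 0 < ‖y - P‖ := norm_pos_iff.2 hyP
    rw [poleField, real_inner_smul_left, norm_mul, norm_inv, Real.norm_of_nonneg (by positivity),
      Real.norm_eq_abs, inv_mul_le_iff₀ (by positivity)]
    calc |⟪y - P, outwardNormal Ω y⟫| ≤ C * ‖y - P‖ ^ 2 := hC y hy
      _ ≤ max C 0 * ‖y - P‖ ^ 2 := by gcongr; exact le_max_left _ _
      _ ≤ (‖y - P‖ ^ 2 + ε ^ 2) * max C 0 := by
        rw [mul_comm]
        gcongr
        linarith [sq_nonneg ε]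
  have hm0 : AEStronglyMeasurable (fun x => ⟪poleField P 0 x, H x⟫) (volume.restrict Ω) :=
    (measurable_poleField_zero P).aestronglyMeasurable.inner hHi.1
  have hm0' : AEStronglyMeasurable (fun y => φ y * ⟪poleField P 0 y, outwardNormal Ω y⟫)
      (boundaryMeasure Ω) :=
    hφb.1.mul ((measurable_poleField_zero P).aestronglyMeasurable.inner hν)
  refine ⟨hi.mono' hm0 (Eventually.of_forall (hb1 0)),
    (hφb.norm.mul_const _).mono' hm0' (hb2 0), ?_⟩
  have l1 : Tendsto (fun ε : ℝ => ∫ x in Ω, ⟪poleField P ε x, H x⟫) (𝓝[>] 0)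
      (𝓝 (∫ x in Ω, ⟪poleField P 0 x, H x⟫)) := by
    refine tendsto_integral_filter_of_dominated_convergence _ ?_
      (Eventually.of_forall fun ε => Eventually.of_forall (hb1 ε)) hi
      (Eventually.of_forall fun x => (tendsto_poleField P x).inner tendsto_const_nhds)
    filter_upwards [self_mem_nhdsWithin] with ε hε
    exact (contDiff_poleField P hε).continuous.aestronglyMeasurable.inner hHi.1
  have l2 : Tendsto
      (fun ε : ℝ => ∫ y, φ y * ⟪poleField P ε y, outwardNormal Ω y⟫ ∂(boundaryMeasure Ω)) (𝓝[>] 0)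
      (𝓝 (∫ y, φ y * ⟪poleField P 0 y, outwardNormal Ω y⟫ ∂(boundaryMeasure Ω))) := by
    refine tendsto_integral_filter_of_dominated_convergence _ ?_
      (Eventually.of_forall hb2) (hφb.norm.mul_const _)
      (Eventually.of_forall fun y => ((tendsto_poleField P y).inner tendsto_const_nhds).const_mul _)
    filter_upwards [self_mem_nhdsWithin] with ε hε
    exact hφb.1.mul ((contDiff_poleField P hε).continuous.aestronglyMeasurable.inner hν)
  have l3 := tendsto_integral_poleDiv hΩ.isOpen (hΩ.isOutwardUnitNormal hP)
    (frontier_subset_closure hP) hU (hfU hP) hφi hφ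
  have l4 := l3.congr' (f₂ := fun ε : ℝ => - (∫ x in Ω, ⟪poleField P ε x, H x⟫) +
      ∫ y, φ y * ⟪poleField P ε y, outwardNormal Ω y⟫ ∂(boundaryMeasure Ω)) (by
    filter_upwards [self_mem_nhdsWithin] with ε hε
    exact green_poleField hΩ hφi hHi hφf
      (fun ψ hψ => hΩ.greenIdentity hU hfU hw hφi hHi hφ hψ) P hε)
  have := tendsto_nhds_unique l4 (l1.neg.add l2)
  linarith

/-- Smoothness up to the boundary supplies, near `P` within `U ∩ closure Ω`, a continuous field `f'`
of derivatives. It is bounded close to `P`; inside `Ω` it is the classical derivative, hence agrees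
almost everywhere with the weak gradient `H`. -/
theorem exists_gradient_bound {Ω U : Set Plane} (hΩ : IsOpen Ω) (hU : IsOpen U) {φ : Plane → ℝ}
    {H : Plane → Plane} (hw : HasWeakGradient Ω φ H) (hφ : ContDiffOn ℝ ∞ φ (U ∩ closure Ω))
    {P : Plane} (hPU : P ∈ U) (hP : P ∈ closure Ω) :
    ∃ C r : ℝ, 0 < r ∧ ∀ᵐ x ∂volume.restrict (Ω ∩ Metric.ball P r), ‖H x‖ ≤ C := by
  have h1 : ContDiffWithinAt ℝ (0 + 1) φ (U ∩ closure Ω) P :=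
    (hφ P ⟨hPU, hP⟩).of_le (by simp)
  obtain ⟨u, hu, -, f', hf', hc⟩ :=
    (contDiffWithinAt_succ_iff_hasFDerivWithinAt (by simp)).1 h1
  rw [insert_eq_of_mem (show P ∈ U ∩ closure Ω from ⟨hPU, hP⟩)] at hu
  obtain ⟨r₁, hr₁, hb₁⟩ := Metric.mem_nhdsWithin_iff.1 hu
  have hev := (tendsto_order.1 hc.continuousWithinAt.norm.tendsto).2 (‖f' P‖ + 1) (by linarith)
  obtain ⟨r₂, hr₂, hb₂⟩ := Metric.mem_nhdsWithin_iff.1 hev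
  obtain ⟨r₃, hr₃, hb₃⟩ := Metric.isOpen_iff.1 hU P hPU
  set r := min (min r₁ r₂) r₃
  have hr : 0 < r := lt_min (lt_min hr₁ hr₂) hr₃
  set W := Ω ∩ Metric.ball P r with hWdef
  have hW : IsOpen W := hΩ.inter Metric.isOpen_ball
  have hWU : W ⊆ U ∩ closure Ω := fun x hx =>
    ⟨hb₃ (Metric.ball_subset_ball (min_le_right _ _) hx.2), subset_closure hx.1⟩
  have hWu : W ⊆ u := fun x hx =>
    hb₁ ⟨Metric.ball_subset_ball ((min_le_left _ _).trans (min_le_left _ _)) hx.2, hWU hx⟩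
  have hae := (hw.mono (inter_subset_left (t := Metric.ball P r))).ae_eq hW
    (hasWeakGradient_of_contDiffOn hW (hφ.mono hWU))
  refine ⟨‖f' P‖ + 1, r, hr, ?_⟩
  filter_upwards [hae, ae_restrict_mem hW.measurableSet] with x hx hxW
  have hd : HasFDerivAt φ (f' x) x :=
    (hf' x (hWu hxW)).hasFDerivAt (mem_of_superset (hW.mem_nhds hxW) hWu)
  rw [hx, gradient, LinearIsometryEquiv.norm_map, hd.fderiv]
  exact le_of_lt (hb₂ ⟨Metric.ball_subset_ball ((min_le_left _ _).trans (min_le_right _ _)) hxW.2,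
    hWu hxW⟩)

/-! ### The singular potential -/

theorem contDiffAt_log_norm_sub {P x : Plane} (h : x ≠ P) :
    ContDiffAt ℝ ∞ (fun y : Plane => Real.log ‖P - y‖) x :=
  ((contDiffAt_const.sub contDiffAt_id).norm ℝ (sub_ne_zero.2 h.symm)).log
    (norm_ne_zero_iff.2 (sub_ne_zero.2 h.symm))

theorem contDiffAt_V {P Q x : Plane} (hP : x ≠ P) (hQ : x ≠ Q) : ContDiffAt ℝ ∞ (V P Q) x :=
  contDiffAt_const.mul ((contDiffAt_log_norm_sub hP).sub (contDiffAt_log_norm_sub hQ))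

theorem hasFDerivAt_log_norm_sub {P x : Plane} (h : x ≠ P) :
    HasFDerivAt (fun y : Plane => Real.log ‖P - y‖)
      (InnerProductSpace.toDual ℝ Plane (poleField P 0 x)) x := by
  have hne : ‖x - P‖ ^ 2 ≠ 0 := pow_ne_zero 2 (norm_ne_zero_iff.2 (sub_ne_zero.2 h))
  have h1 : HasFDerivAt (fun y : Plane => y - P) (ContinuousLinearMap.id ℝ Plane) x :=
    (hasFDerivAt_id x).sub_const P
  have h2 := (h1.norm_sq.log hne).const_mul (1 / 2 : ℝ)
  have e : (fun y : Plane => Real.log ‖P - y‖) = fun y => 1 / 2 * Real.log (‖y - P‖ ^ 2) := by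
    funext y
    rw [Real.log_pow, norm_sub_rev]
    push_cast
    ring
  rw [e]
  refine h2.congr_fderiv (ContinuousLinearMap.ext fun v => ?_)
  rw [InnerProductSpace.toDual_apply_apply, poleField, real_inner_smul_left, inner_sub_left]
  simp
  ring

theorem gradient_V {P Q x : Plane} (hP : x ≠ P) (hQ : x ≠ Q) :
    gradient (V P Q) x = -(1 / Real.pi) • (poleField P 0 x - poleField Q 0 x) := by
  have h := ((hasFDerivAt_log_norm_sub hP).sub (hasFDerivAt_log_norm_sub hQ)).const_mul (-(1 / Real.pi))
  have h' : HasGradientAt (V P Q) (-(1 / Real.pi) • (poleField P 0 x - poleField Q 0 x)) x := by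
    rw [hasGradientAt_iff_hasFDerivAt, map_smul, map_sub]
    exact h
  exact h'.gradient

theorem Psi_eq (Ω : Set Plane) (P Q y : Plane) : Psi Ω P Q y =
    -(1 / Real.pi) * (⟪poleField P 0 y, outwardNormal Ω y⟫ -
      ⟪poleField Q 0 y, outwardNormal Ω y⟫) := by
  rw [Psi, poleField_zero, poleField_zero, inner_sub_left]

/-- On `Ω`, `γ = 1 + ∑ (k_j - 1) 1_{D_j}`, the components being disjoint. The values of `γ` off `Ω`
are arbitrary, hence the restricted measure. -/
theorem IsConductivity.exists_bound {Ω : Set Plane} {m : ℕ} {D : Fin m → Set Plane}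
    (hD : IsInclusion Ω D) {γ : Plane → ℝ} (hγ : IsConductivity Ω D γ) (hΩ : IsOpen Ω) :
    AEStronglyMeasurable γ (volume.restrict Ω) ∧ ∃ M, ∀ x ∈ Ω, ‖γ x‖ ≤ M := by
  choose k hk0 hk using hγ.const_on_component
  set g : Plane → ℝ := fun x => 1 + ∑ j, (D j).indicator (fun _ => k j - 1) x with hg
  have hgm : Measurable g := measurable_const.add (Finset.measurable_sum _ fun j _ =>
    measurable_const.indicator (hD.isOpen j).measurableSet)
  have hγg : ∀ x ∈ Ω, γ x = g x := by
    intro x hx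
    by_cases hxD : x ∈ ⋃ j, D j
    · obtain ⟨j, hj⟩ := mem_iUnion.1 hxD
      rw [hk j x hj, hg]
      simp only
      rw [Finset.sum_eq_single j]
      · simp [hj]
      · intro i _ hij
        exact indicator_of_notMem (fun hi => disjoint_left.1 (hD.disjoint_closure i j hij)
          (subset_closure hi) (subset_closure hj)) _
      · simp
    · rw [hγ.eq_one x ⟨hx, hxD⟩, hg]
      simp only
      rw [Finset.sum_eq_zero, add_zero]
      exact fun i _ => indicator_of_notMem (fun hi => hxD (mem_iUnion.2 ⟨i, hi⟩)) _
  refine ⟨hgm.aestronglyMeasurable.congr ?_, 1 + ∑ j, ‖k j - 1‖, fun x hx => ?_⟩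
  · exact (ae_restrict_iff' hΩ.measurableSet).2
      (Eventually.of_forall fun x hx => (hγg x hx).symm)
  · rw [hγg x hx, hg]
    refine (norm_add_le _ _).trans (add_le_add (by simp) ((norm_sum_le _ _).trans ?_))
    exact Finset.sum_le_sum fun j _ => norm_indicator_le_norm_self _ _

end PointCurrent

end

/-! ### The Neumann problem with point sources -/

open PointCurrent in
theorem proposition2p1 (Ω : Set Plane) (hΩ : IsSmoothBoundedDomain Ω)
    (m : ℕ) (D : Fin m → Set Plane) (hD : IsInclusion Ω D)
    (γ : Plane → ℝ) (hγ : IsConductivity Ω D γ)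
    (P Q : Plane) (hP : P ∈ frontier Ω) (hQ : Q ∈ frontier Ω) (hPQ : P ≠ Q)
    (e : Plane → ℝ) (he : IsCorrector Ω γ P Q e) :
    (∃ G : Plane → Plane, HasWeakGradient Ω (fun x => V P Q x + e x) G) ∧
    ∀ φ : Plane → ℝ, MemH1 Ω φ → IsSmoothNearBoundary Ω φ →
      ∀ G H : Plane → Plane,
        HasWeakGradient Ω (fun x => V P Q x + e x) G → HasWeakGradient Ω φ H →
        IntegrableOn (fun x => γ x * inner ℝ (G x) (H x)) Ω ∧
        ∫ x in Ω, γ x * inner ℝ (G x) (H x) = φ P - φ Q := by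
  have hne : ∀ R ∈ frontier Ω, ∀ x ∈ Ω, x ≠ R := by
    rintro R hR x hx rfl
    have := hR.2
    rw [hΩ.isOpen.interior_eq] at this
    exact this hx
  obtain ⟨E, hE⟩ := he.memH1
  have hV : HasWeakGradient Ω (V P Q) (gradient (V P Q)) :=
    hasWeakGradient_of_contDiffOn hΩ.isOpen fun x hx =>
      (contDiffAt_V (hne P hP x hx) (hne Q hQ x hx)).contDiffWithinAt
  have hsum := hV.add hE.weak
  refine ⟨⟨_, hsum⟩, fun φ hφ ⟨U, hU, hfU, hφU⟩ G H hG hH => ?_⟩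
  have := hΩ.isFiniteMeasure_boundaryMeasure
  have hfin : IsFiniteMeasure (volume.restrict Ω) :=
    ⟨by simpa using hΩ.isBounded.measure_lt_top⟩
  obtain ⟨H', hH'⟩ := hφ
  -- `H` is an arbitrary weak gradient of `φ`; it is square integrable because it equals `H'` almost
  -- everywhere.
  have hφH : HasH1Gradient Ω φ H :=
    ⟨hH'.memLp, (memLp_congr_ae (hH.ae_eq hΩ.isOpen hH'.weak)).2 hH'.memLp_gradient, hH⟩
  have hφi : IntegrableOn φ Ω := hφH.memLp.integrable one_le_two
  have hHi : IntegrableOn H Ω := hφH.memLp_gradient.integrable one_le_two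
  have hpole : ∀ R ∈ frontier Ω, IntegrableOn (fun x => ‖x - R‖⁻¹ * ‖H x‖) Ω := fun R hR => by
    obtain ⟨C, r, hr, hb⟩ := exists_gradient_bound hΩ.isOpen hU hH hφU (hfU hR)
      (frontier_subset_closure hR)
    exact integrableOn_inv_norm_mul hHi hr hb
  obtain ⟨iP, bP, eP⟩ :=
    green_pole hΩ hU hfU hH hφi hHi hφU.continuousOn hP (hpole P hP)
  obtain ⟨iQ, bQ, eQ⟩ :=
    green_pole hΩ hU hfU hH hφi hHi hφU.continuousOn hQ (hpole Q hQ)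
  have eV : ∀ x ∈ Ω, inner ℝ (gradient (V P Q) x) (H x) = -(1 / Real.pi) *
      (inner ℝ (poleField P 0 x) (H x) - inner ℝ (poleField Q 0 x) (H x)) := fun x hx => by
    rw [gradient_V (hne P hP x hx) (hne Q hQ x hx), real_inner_smul_left, inner_sub_left]
  have iV : IntegrableOn (fun x => inner ℝ (gradient (V P Q) x) (H x)) Ω :=
    IntegrableOn.congr_fun ((iP.sub iQ).const_mul (-(1 / Real.pi)))
      (fun x hx => (eV x hx).symm) hΩ.isOpen.measurableSet
  have hVint : ∫ x in Ω, inner ℝ (gradient (V P Q) x) (H x) =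
      (∫ y, Psi Ω P Q y * φ y ∂(boundaryMeasure Ω)) + (φ P - φ Q) := by
    have e2 : ∀ y, Psi Ω P Q y * φ y = -(1 / Real.pi) *
        (φ y * inner ℝ (poleField P 0 y) (outwardNormal Ω y) -
          φ y * inner ℝ (poleField Q 0 y) (outwardNormal Ω y)) := fun y => by
      rw [Psi_eq]
      ring
    -- The factor `-(1/π)` of `V` turns the pole contributions `-π φ(P)` and `-π φ(Q)` into `φ P - φ
    -- Q`, and the boundary integrals into the flux `Psi`.
    rw [setIntegral_congr_fun hΩ.isOpen.measurableSet eV, integral_const_mul,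
      integral_sub iP iQ, eP, eQ]
    simp only [e2]
    rw [integral_const_mul, integral_sub bP bQ]
    have := Real.pi_ne_zero
    field_simp
    ring
  obtain ⟨hγm, M, hM⟩ := hγ.exists_bound hD hΩ.isOpen
  have hγint : ∀ {f : Plane → ℝ}, IntegrableOn f Ω → IntegrableOn (fun x => γ x * f x) Ω :=
    fun hf => hf.bdd_mul (c := M) hγm
      ((ae_restrict_iff' hΩ.isOpen.measurableSet).2 (Eventually.of_forall hM))
  have iE : IntegrableOn (fun x => inner ℝ (E x) (H x)) Ω :=
    (hE.memLp_gradient.norm.integrable_mul hφH.memLp_gradient.norm).mono'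
      (hE.memLp_gradient.1.inner hφH.memLp_gradient.1)
      (Eventually.of_forall fun x => norm_inner_le_norm _ _)
  have hae : (fun x => γ x * inner ℝ (G x) (H x)) =ᵐ[volume.restrict Ω] fun x =>
      γ x * inner ℝ (gradient (V P Q) x) (H x) + γ x * inner ℝ (E x) (H x) := by
    filter_upwards [hG.ae_eq hΩ.isOpen hsum] with x hx
    rw [hx, inner_add_left, mul_add]
  have hweak := he.weak_eq E φ H φ hE hφH
    (hasTrace_self hΩ.isOpen hΩ.isBounded hU hfU hφH hφU.continuousOn)
  refine ⟨((hγint iV).add (hγint iE)).congr hae.symm, ?_⟩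
  have e3 : ∀ x, (γ x - 1) * inner ℝ (gradient (V P Q) x) (H x) =
      γ x * inner ℝ (gradient (V P Q) x) (H x) - inner ℝ (gradient (V P Q) x) (H x) :=
    fun x => by ring
  -- The part of the source containing `γ` cancels `∫ γ ∇V·∇φ`; what remains is `∫ ∇V·∇φ`, whose
  -- boundary flux cancels the Neumann datum.
  simp only [e3] at hweak
  rw [integral_sub (hγint iV) iV, hVint] at hweak
  rw [integral_congr_ae hae, integral_add (hγint iV) (hγint iE), hweak]
  ring
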